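/- Let $\alpha,\beta,\delta$ be integers with $\gcd(\alpha,\beta)=1$, $0<\alpha<\beta$, $\delta\ge1$, and let $q:[0,1]\to\mathbb{R}$ be bounded and measurable with $q(1-x)=q(x)$. Let $T$ be the metric graph obtained from the square lattice (vertex set $\mathbb{Z}^2$, horizontally and vertically adjacent vertices joined by edges, each identified with $(0,1)$) by identifying points that differ by a multiple of $(\alpha\delta,\beta\delta)$. Let $\mathfrak{h}$ and $\mathfrak{v}$ be the shifts of $T$ by $(1,0)$ and $(0,1)$, acting on functions by $(\mathfrak{g}f)(x)=f(\mathfrak{g}x)$. Let $\sigma_D$ be the set of real $\lambda$ such that the solution $s$ of $-s''+qs=\lambda s$ with $s(0)=0$, $s'(0)=1$ has $s(1)=0$. For $\lambda\in\mathbb{R}$ let $V_\lambda$ be the space of functions $u:T\to\mathbb{C}$ that are continuous, lie in $H^2$ of each edge, satisfy $-u''+qu=\lambda u$ on each edge, and satisfy the Neumann condition at each vertex (the derivatives directed into the incident edges sum to zero). Direct all edges rightward or downward; the half-open edge consists of the edge and its initial vertex. Let $S$ be the set of half-open edges that meet the image in $T$ of the line through $(0,0)$ and $(\alpha\delta,\beta\delta)$,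 and let $\mathcal{V}_0$ be the set of all ($2\beta\delta$) endpoints of the edges in $S$. For $u\in V_\lambda$ and $m\in\mathbb{Z}$ let $\underline u(m)\in\mathbb{C}^{\mathcal{V}_0}$ be the restriction of $u$ to $\mathfrak{h}^m\mathcal{V}_0$, i.e. $\underline u(m)(p)=u(\mathfrak{h}^mp)$. For $u,v\in V_\lambda$ put $$[u,v]=\sum_{e\in S}\frac1{2i}\big(\bar u v'-\bar u'v\big)\big|_e ,$$ each term being constant along the directed edge $e$. **Theorem.** Let $\lambda\in\mathbb{R}\setminus\sigma_D$. There is exactly one invertible linear operator $P_\lambda$ on $\mathbb{C}^{\mathcal{V}_0}$ (the propagator) such that $\underline u(m+1)=P_\lambda\underline u(m)$ for all $u\in V_\lambda$ and $m\in\mathbb{Z}$. If $w$ is an eigenvalue of $P_\lambda$ with eigenvector $\underline u_0$, there is a unique $u\in V_\lambda$ with $\underline u(0)=\underline u_0$ (the corresponding eigenmode); it satisfies $\mathfrak{h}u=wu$ and $\underline u(m)=w^m\underline u_0$ for all $m\in\mathbb{Z}$. Suppose that $P_\lambda$ has $2\beta\delta$ distinct eigenvalues. Then $V_\lambda$ is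 spanned by the corresponding $2\beta\delta$ eigenmodes. There is an integer $N$, $0\le N\le\beta\delta$, such that the eigenvalues are, without repetition, $$w_{(j)},\ \bar w_{(j)},\quad |w_{(j)}|=1\quad(0<j\le N),\qquad w_{(j)},\ \bar w_{(j)}^{-1},\quad 0<|w_{(j)}|<1\quad(N<j\le\beta\delta),$$ and the corresponding eigenmodes $u_{(j1)}$ (for $w_{(j)}$) and $u_{(j2)}$ (for $\bar w_{(j)}$, respectively $\bar w_{(j)}^{-1}$), which are also eigenfunctions of $\mathfrak{v}$, can be chosen such that, for $k,\ell\in\{1,2\}$, $$[u_{(jk)},u_{(j\ell)}]=(-1)^\ell\delta_{k\ell}\ (0<j\le N),\qquad [u_{(jk)},u_{(j\ell)}]=1-\delta_{k\ell}\ (N<j\le\beta\delta),\qquad [u_{(jk)},u_{(j'\ell)}]=0\ (j\ne j').$$ Call a mode $u$ with multiplier $w$ rightward if $|w|<1$, or $|w|=1$ and $[u,u]>0$; and leftward if $|w|>1$, or $|w|=1$ and $[u,u]<0$. Then each pair $u_{(j1)},u_{(j2)}$ consists of one rightward and one leftward mode, so that there are exactly $\beta\delta$ rightward and $\beta\delta$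 leftward modes. -/

import Mathlib

open scoped ComplexConjugate

noncomputable section

namespace QuantumTube

open MeasureTheory

/-! ### The metric graph -/

/-- The symmetry group `G = ℤ² / ⟨(αδ, βδ)⟩` of the tube, written additively. It acts simply
transitively on the vertices of the tube, so its elements also serve as the vertices. -/
abbrev G (α β δ : ℕ) : Type :=
  (ℤ × ℤ) ⧸ AddSubgroup.zmultiples (((α * δ : ℕ) : ℤ), ((β * δ : ℕ) : ℤ))

/-- The class of `(m, n)` in `G`. -/
def vtx (α β δ : ℕ) (m n : ℤ) : G α β δ := QuotientAddGroup.mk (m, n)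

/-- The horizontal shift. -/
def hh (α β δ : ℕ) : G α β δ := vtx α β δ 1 0

/-- The vertical shift. -/
def vv (α β δ : ℕ) : G α β δ := vtx α β δ 0 1

/-- The two directions of edges: every edge is directed rightward or downward. -/
inductive Dir : Type
  | right : Dir
  | down : Dir

/-- The directed edges of the tube: `(p, right)` goes from `p` to `p + h`, and `(p, down)` goes
from `p` to `p - v`. -/
abbrev Edge (α β δ : ℕ) : Type := G α β δ × Dir

/-- Initial vertex (left, respectively upper, endpoint) of an edge. -/
def Edge.src {α β δ : ℕ} (e : Edge α β δ) : G α β δ := e.1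

/-- Terminal vertex (right, respectively lower, endpoint) of an edge. -/
def Edge.tgt {α β δ : ℕ} : Edge α β δ → G α β δ
  | (p, Dir.right) => p + hh α β δ
  | (p, Dir.down) => p - vv α β δ

/-- The points of the tube `T`: its vertices, and the points of its open edges, each of which is
identified with `(0, 1)`, the coordinate increasing in the direction of the edge. -/
inductive Tube (α β δ : ℕ) : Type
  | vertex (p : G α β δ) : Tube α β δ
  | interior (e : Edge α β δ) (x : Set.Ioo (0 : ℝ) 1) : Tube α β δ

/-- The action of `g ∈ G` on the tube by translation. -/
def shift {α β δ : ℕ} (g : G α β δ) : Tube α β δ → Tube α β δ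
  | Tube.vertex p => Tube.vertex (p + g)
  | Tube.interior e x => Tube.interior (e.1 + g, e.2) x

open Classical in
/-- The restriction `f_e` of a function `f` on the tube to the closed edge `e`, as a function of
the coordinate in `[0, 1]` (with an irrelevant constant extension outside of `[0, 1]`). -/
def onEdge {α β δ : ℕ} (f : Tube α β δ → ℂ) (e : Edge α β δ) (x : ℝ) : ℂ :=
  if hx : x ∈ Set.Ioo (0 : ℝ) 1 then f (Tube.interior e ⟨x, hx⟩)
  else if x ≤ 0 then f (Tube.vertex e.src)
  else f (Tube.vertex e.tgt)

/-! ### The Schrödinger operator -/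

/-- The derivative of a function on `[0, 1]` (one-sided at the endpoints). -/
def D (y : ℝ → ℂ) : ℝ → ℂ := derivWithin y (Set.Icc 0 1)

/-- `y` (that is, its restriction to `[0, 1]`) is in the Sobolev space `H²(0, 1)`, and `y₂` is its
second weak derivative: `y` is differentiable on `[0, 1]`, and `y'` is an antiderivative of
the square-integrable function `y₂`. -/
structure IsH2 (y y₂ : ℝ → ℂ) : Prop where
  diff : DifferentiableOn ℝ y (Set.Icc 0 1)
  memLp : MemLp y₂ 2 (volume.restrict (Set.Ioo (0 : ℝ) 1))
  eq_integral : ∀ x ∈ Set.Icc (0 : ℝ) 1, D y x = D y 0 + ∫ t in (0 : ℝ)..x, y₂ t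

/-- `y ∈ H²(0, 1)` and `-y'' + q y = lam y` on `(0, 1)`. -/
def SolvesODE (q : ℝ → ℝ) (lam : ℝ) (y : ℝ → ℂ) : Prop :=
  ∃ y₂ : ℝ → ℂ, IsH2 y y₂ ∧
    ∀ᵐ x ∂(volume.restrict (Set.Ioo (0 : ℝ) 1)), -y₂ x + (q x : ℂ) * y x = (lam : ℂ) * y x

/-- The Dirichlet spectrum `σ_D` of an edge: those real `lam` for which the solution
`s(lam, ·)` with `s(lam, 0) = 0` and `s'(lam, 0) = 1` satisfies `s(lam, 1) = 0`. -/
def dirichletSpectrum (q : ℝ → ℝ) : Set ℝ :=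
  {lam | ∃ s : ℝ → ℂ, SolvesODE q lam s ∧ s 0 = 0 ∧ D s 0 = 1 ∧ s 1 = 0}

/-- The Neumann condition at the vertex `p`: the derivatives at `p` along the four edges incident
to `p`, directed into the edges, add up to zero. -/
def Neumann {α β δ : ℕ} (f : Tube α β δ → ℂ) (p : G α β δ) : Prop :=
  D (onEdge f (p, Dir.right)) 0 - D (onEdge f (p - hh α β δ, Dir.right)) 1
    + D (onEdge f (p, Dir.down)) 0 - D (onEdge f (p + vv α β δ, Dir.down)) 1 = 0

theorem onEdge_add {α β δ : ℕ} (f g : Tube α β δ → ℂ) (e : Edge α β δ) :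
    onEdge (f + g) e = onEdge f e + onEdge g e := by
  funext x
  simp only [onEdge, Pi.add_apply]
  split_ifs <;> rfl

theorem onEdge_smul {α β δ : ℕ} (c : ℂ) (f : Tube α β δ → ℂ) (e : Edge α β δ) :
    onEdge (c • f) e = c • onEdge f e := by
  funext x
  simp only [onEdge, Pi.smul_apply]
  split_ifs <;> rfl

theorem D_add {y z : ℝ → ℂ} (hy : DifferentiableOn ℝ y (Set.Icc 0 1))
    (hz : DifferentiableOn ℝ z (Set.Icc 0 1)) {x : ℝ} (hx : x ∈ Set.Icc (0 : ℝ) 1) :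
    D (y + z) x = D y x + D z x :=
  derivWithin_add (hy x hx) (hz x hx)

theorem D_smul (c : ℂ) {y : ℝ → ℂ} (hy : DifferentiableOn ℝ y (Set.Icc 0 1))
    {x : ℝ} (hx : x ∈ Set.Icc (0 : ℝ) 1) : D (c • y) x = c * D y x :=
  derivWithin_const_smul c (hy x hx)

theorem intervalIntegrable_of_memLp {y₂ : ℝ → ℂ}
    (h : MemLp y₂ 2 (volume.restrict (Set.Ioo (0 : ℝ) 1))) {x : ℝ}
    (hx : x ∈ Set.Icc (0 : ℝ) 1) : IntervalIntegrable y₂ volume 0 x := by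
  have h1 : IntegrableOn y₂ (Set.Ioo (0 : ℝ) 1) := h.integrable (by norm_num)
  rw [intervalIntegrable_iff_integrableOn_Ioo_of_le hx.1]
  exact h1.mono_set (Set.Ioo_subset_Ioo_right hx.2)

theorem SolvesODE.diff {q : ℝ → ℝ} {lam : ℝ} {y : ℝ → ℂ} (h : SolvesODE q lam y) :
    DifferentiableOn ℝ y (Set.Icc 0 1) := by
  obtain ⟨y₂, h, -⟩ := h
  exact h.diff

theorem SolvesODE.add {q : ℝ → ℝ} {lam : ℝ} {y z : ℝ → ℂ} (hy : SolvesODE q lam y)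
    (hz : SolvesODE q lam z) : SolvesODE q lam (y + z) := by
  obtain ⟨y₂, hy, hy'⟩ := hy
  obtain ⟨z₂, hz, hz'⟩ := hz
  refine ⟨y₂ + z₂, ⟨hy.diff.add hz.diff, hy.memLp.add hz.memLp, fun x hx => ?_⟩, ?_⟩
  · rw [D_add hy.diff hz.diff hx, D_add hy.diff hz.diff ⟨le_rfl, zero_le_one⟩,
      hy.eq_integral x hx, hz.eq_integral x hx]
    simp only [Pi.add_apply]
    rw [intervalIntegral.integral_add (intervalIntegrable_of_memLp hy.memLp hx)
      (intervalIntegrable_of_memLp hz.memLp hx)]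
    ring
  · filter_upwards [hy', hz'] with x h1 h2
    simp only [Pi.add_apply]
    linear_combination h1 + h2

theorem SolvesODE.smul {q : ℝ → ℝ} {lam : ℝ} (c : ℂ) {y : ℝ → ℂ} (hy : SolvesODE q lam y) :
    SolvesODE q lam (c • y) := by
  obtain ⟨y₂, hy, hy'⟩ := hy
  refine ⟨c • y₂, ⟨hy.diff.const_smul c, hy.memLp.const_smul c, fun x hx => ?_⟩, ?_⟩
  · rw [D_smul c hy.diff hx, D_smul c hy.diff ⟨le_rfl, zero_le_one⟩, hy.eq_integral x hx]
    simp only [Pi.smul_apply]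
    rw [intervalIntegral.integral_smul, smul_eq_mul]
    ring
  · filter_upwards [hy'] with x h1
    simp only [Pi.smul_apply, smul_eq_mul]
    linear_combination c * h1

/-- The eigenspace `V_lam` of `A` in `H²_loc(T)`: functions on the tube that are `H²` on every
closed edge (in particular continuous across the vertices), satisfy the Neumann
condition at every vertex, and satisfy `(A - lam) f = 0` on every edge. -/
def V (α β δ : ℕ) (q : ℝ → ℝ) (lam : ℝ) : Submodule ℂ (Tube α β δ → ℂ) where
  carrier := {f | (∀ e, SolvesODE q lam (onEdge f e)) ∧ ∀ p, Neumann f p}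
  add_mem' := by
    rintro f g ⟨hf, hf'⟩ ⟨hg, hg'⟩
    refine ⟨fun e => ?_, fun p => ?_⟩
    · rw [onEdge_add]
      exact (hf e).add (hg e)
    · have h1 := hf' p
      have h2 := hg' p
      unfold Neumann at h1 h2 ⊢
      simp only [onEdge_add]
      rw [D_add (hf _).diff (hg _).diff ⟨le_rfl, zero_le_one⟩,
        D_add (hf _).diff (hg _).diff ⟨zero_le_one, le_rfl⟩,
        D_add (hf _).diff (hg _).diff ⟨le_rfl, zero_le_one⟩,
        D_add (hf _).diff (hg _).diff ⟨zero_le_one, le_rfl⟩]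
      linear_combination h1 + h2
  zero_mem' := by
    have h0 : ∀ e : Edge α β δ, onEdge (0 : Tube α β δ → ℂ) e = fun _ => 0 := by
      intro e
      funext x
      simp [onEdge]
    have hD : D (fun _ : ℝ => (0 : ℂ)) = fun _ => 0 := by
      funext x
      simp [D]
    refine ⟨fun e => ⟨fun _ => 0, ⟨?_, ?_, ?_⟩, ?_⟩, fun p => ?_⟩
    · rw [h0]
      exact differentiableOn_const 0
    · exact MemLp.zero
    · intro x _
      rw [h0, hD]
      simp
    · rw [h0]
      simp
    · unfold Neumann
      simp only [h0, hD]
      simp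
  smul_mem' := by
    rintro c f ⟨hf, hf'⟩
    refine ⟨fun e => ?_, fun p => ?_⟩
    · rw [onEdge_smul]
      exact (hf e).smul c
    · have h1 := hf' p
      unfold Neumann at h1 ⊢
      simp only [onEdge_smul]
      rw [D_smul c (hf _).diff ⟨le_rfl, zero_le_one⟩,
        D_smul c (hf _).diff ⟨zero_le_one, le_rfl⟩,
        D_smul c (hf _).diff ⟨le_rfl, zero_le_one⟩,
        D_smul c (hf _).diff ⟨zero_le_one, le_rfl⟩]
      linear_combination c * h1

/-! ### The loop around the tube, the propagator, and the flux -/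

/-- The half-open edge of the planar lattice that emanates from `(m, n)` rightward or downward,
containing `(m, n)` but not its other endpoint, meets the line `L` through `(0, 0)` and
`(αδ, βδ)`, that is, the line `β x = α y`. -/
def MeetsLine (α β : ℕ) (m n : ℤ) : Dir → Prop
  | Dir.right => ∃ t ∈ Set.Ico (0 : ℝ) 1, (β : ℝ) * (m + t) = α * n
  | Dir.down => ∃ t ∈ Set.Ico (0 : ℝ) 1, (β : ℝ) * m = α * (n - t)

/-- The half-open directed edges of the tube that meet the loop `L` around the tube. -/
def crossing (α β δ : ℕ) : Set (Edge α β δ) :=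
  {e | ∃ m n : ℤ, e.1 = vtx α β δ m n ∧ MeetsLine α β m n e.2}

/-- The set `𝒱₀` of vertices of the closure of the fundamental domain `W`. As `W` consists of the
half-open edges that meet `L`, and of all edges between vertices that belong to these, the
vertices of its closure are the endpoints of the half-open edges that meet `L`. -/
def V0 (α β δ : ℕ) : Set (G α β δ) :=
  {p | ∃ e ∈ crossing α β δ, p = e.src ∨ p = e.tgt}

/-- The restriction `u(m)` of `u` to the vertices of the `m`-th horizontal shift of `𝒱₀`, considered
as a function on `𝒱₀`. -/
def restr {α β δ : ℕ} (u : Tube α β δ → ℂ) (m : ℤ) : V0 α β δ → ℂ :=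
  fun p => u (Tube.vertex (p.1 + m • hh α β δ))

/-- `P` is the propagator `P_lam`: an invertible operator with `u(m + 1) = P u(m)` for all
`u ∈ V_lam` and all integers `m`. -/
def IsPropagator {α β δ : ℕ} (q : ℝ → ℝ) (lam : ℝ) (P : Module.End ℂ (V0 α β δ → ℂ)) : Prop :=
  Function.Bijective P ∧
    ∀ u ∈ V α β δ q lam, ∀ m : ℤ, restr u (m + 1) = P (restr u m)

/-- The cross-flux `(2i)⁻¹ (ū v' - ū' v)` of `u` and `v` along a directed edge. For `u`, `v` in
`V_lam`, `lam` real, it is constant along the edge; it is evaluated here at the initial vertex. -/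
def edgeFlux {α β δ : ℕ} (u v : Tube α β δ → ℂ) (e : Edge α β δ) : ℂ :=
  (2 * Complex.I)⁻¹ *
    (conj (onEdge u e 0) * D (onEdge v e) 0 - conj (D (onEdge u e) 0) * onEdge v e 0)

/-- The energy flux `[u(0), v(0)]` of `u`, `v` in `V_lam`: the sum of the cross-fluxes along the
half-open edges that meet the loop `L`, directed rightward and downward. -/
def flux {α β δ : ℕ} (u v : Tube α β δ → ℂ) : ℂ :=
  ∑ᶠ e ∈ crossing α β δ, edgeFlux u v e

/-- A mode with multiplier `w` is rightward if it is rightward propagating (`|w| = 1` and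
`[u, u] > 0`) or rightward evanescent (`|w| < 1`). -/
def IsRightward {α β δ : ℕ} (w : ℂ) (u : Tube α β δ → ℂ) : Prop :=
  (‖w‖ = 1 ∧ 0 < (flux u u).re) ∨ ‖w‖ < 1

/-- A mode with multiplier `w` is leftward if it is leftward propagating (`|w| = 1` and
`[u, u] < 0`) or leftward evanescent (`1 < |w|`). -/
def IsLeftward {α β δ : ℕ} (w : ℂ) (u : Tube α β δ → ℂ) : Prop :=
  (‖w‖ = 1 ∧ (flux u u).re < 0) ∨ 1 < ‖w‖

end QuantumTube

end

noncomputable section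

namespace QuantumTube

open MeasureTheory

/-! ### The Volterra equation with a bounded measurable kernel -/

/-! For `lam` outside the Dirichlet spectrum, a solution on an edge is determined by its two end
values, which are arbitrary, and its end derivatives are real linear combinations of them with
coefficients `A` and `B ≠ 0` (`exists_dirichletToNeumann`). The Neumann condition at `p` then says
that the values at the four neighbours add up to `κ` times the value at `p`, with `κ = -4A/B` real,
and the flux becomes `B/(2i)` times a sum of discrete Wronskians. What remains is combinatorics and
linear algebra.

The combinatorics rests on the height `βm - αn`, which is well defined on the tube; `h` raises it by
`β` and `v` lowers it by `α`. The set `𝒱₀` is the band of heights in `(-β, β]`. Since `α < β`, the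
highest and lowest neighbours of `p` are `p + h` and `p - h`, so the difference equation can be
solved for either, and every function on `𝒱₀` extends uniquely to a solution. Thus `V_lam` is
isomorphic to the functions on `𝒱₀`, has dimension `2βδ`, and the propagator is the shift `h`
carried over by this isomorphism.

The flux is a Hermitian form `F` on `V_lam`. It is invariant under `T = h`, because the Wronskian
current has no sources between the loop and its translate; it is nondegenerate
(`discreteFlux_nondegenerate`); and complex conjugation commutes with `T` and reverses its sign. By
invariance, eigenvectors for `z` and `y` are orthogonal unless `conj z * y = 1`. If the spectrum is
simple, nondegeneracy forces `(conj z)⁻¹` to be an eigenvalue together with `z`. Off the unit circle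
this pairs two isotropic eigenvectors. On the circle `z` is paired with itself, so its eigenvector
has nonzero real flux, and conjugation provides `conj z` with flux of the opposite sign; in
particular `±1` cannot occur. Taking the eigenvalues of negative flux on the circle and those inside
the disk selects one from each pair, which gives the normal form
`IsFluxForm.exists_canonical_basis`. As `v` commutes with `h`, it preserves the eigenlines. -/

theorem intervalIntegrable_mul_of_bounded {g f : ℝ → ℂ} {M : ℝ}
    (hg : AEStronglyMeasurable g volume) (hM : ∀ x, ‖g x‖ ≤ M) (hf : Continuous f) (a b : ℝ) :
    IntervalIntegrable (fun t => g t * f t) volume a b := by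
  have h := hf.intervalIntegrable (μ := volume) a b
  rw [intervalIntegrable_iff] at h ⊢
  exact Integrable.bdd_mul h hg.restrict (Filter.Eventually.of_forall hM)

/-- The twice iterated integral of `g * f`. -/
def volterra (g f : ℝ → ℂ) (x : ℝ) : ℂ := ∫ t in (0 : ℝ)..x, ∫ s in (0 : ℝ)..t, g s * f s

theorem continuous_primitive_mul {g f : ℝ → ℂ} {M : ℝ}
    (hg : AEStronglyMeasurable g volume) (hM : ∀ x, ‖g x‖ ≤ M) (hf : Continuous f) :
    Continuous fun t => ∫ s in (0 : ℝ)..t, g s * f s :=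
  intervalIntegral.continuous_primitive (intervalIntegrable_mul_of_bounded hg hM hf) 0

theorem hasDerivAt_volterra {g f : ℝ → ℂ} {M : ℝ}
    (hg : AEStronglyMeasurable g volume) (hM : ∀ x, ‖g x‖ ≤ M) (hf : Continuous f) (x : ℝ) :
    HasDerivAt (volterra g f) (∫ s in (0 : ℝ)..x, g s * f s) x :=
  (continuous_primitive_mul hg hM hf).integral_hasStrictDerivAt 0 x |>.hasDerivAt

theorem integral_const_mul_exp (c : ℝ) {k : ℝ} (hk : 0 < k) (x : ℝ) :
    ∫ t in (0 : ℝ)..x, c * Real.exp (k * t) = c * ((Real.exp (k * x) - 1) / k) := by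
  rw [intervalIntegral.integral_const_mul]
  congr 1
  have h : ∀ t ∈ Set.uIcc 0 x, HasDerivAt (fun t => Real.exp (k * t) / k) (Real.exp (k * t)) t := by
    intro t _
    have := ((hasDerivAt_id t).const_mul k).exp.div_const k
    simp only [id, mul_one] at this
    rwa [mul_div_assoc, div_self hk.ne', mul_one] at this
  rw [intervalIntegral.integral_eq_sub_of_hasDerivAt h
    (Continuous.intervalIntegrable (by fun_prop) _ _)]
  simp [sub_div]

/-- In the sup norm weighted by `exp (-k x)`, each integration gains a factor `1/k`; two of them
make the operator small for large `k`, with no smallness assumption on `g`. -/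
theorem norm_volterra_le {g f : ℝ → ℂ} {M m k : ℝ} (hM : ∀ x, ‖g x‖ ≤ M)
    (hM0 : 0 ≤ M) (hm : 0 ≤ m) (hk : 0 < k)
    (h : ∀ x ∈ Set.Icc (0 : ℝ) 1, ‖f x‖ ≤ m * Real.exp (k * x)) {x : ℝ}
    (hx : x ∈ Set.Icc (0 : ℝ) 1) : ‖volterra g f x‖ ≤ M / k ^ 2 * m * Real.exp (k * x) := by
  have key : ∀ c : ℝ, 0 ≤ c → ∀ F : ℝ → ℂ,
      (∀ x ∈ Set.Icc (0 : ℝ) 1, ‖F x‖ ≤ c * Real.exp (k * x)) → ∀ x ∈ Set.Icc (0 : ℝ) 1,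
      ‖∫ t in (0 : ℝ)..x, F t‖ ≤ c / k * Real.exp (k * x) := by
    intro c hc F hF x hx
    have h1 : ‖∫ t in (0 : ℝ)..x, F t‖ ≤ ∫ t in (0 : ℝ)..x, c * Real.exp (k * t) := by
      refine intervalIntegral.norm_integral_le_of_norm_le hx.1
        (Filter.Eventually.of_forall fun t ht => hF t ⟨ht.1.le, ht.2.trans hx.2⟩)
        (Continuous.intervalIntegrable (by fun_prop) _ _)
    rw [integral_const_mul_exp c hk] at h1
    refine h1.trans ?_
    rw [div_mul_eq_mul_div, mul_div_assoc]
    gcongr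
    linarith
  have h1 := key (M * m) (by positivity) (fun s => g s * f s) (fun s hs => by
    rw [norm_mul, mul_assoc]
    exact mul_le_mul (hM s) (h s hs) (norm_nonneg _) hM0)
  have h2 := key (M * m / k) (by positivity) _ h1 x hx
  refine h2.trans (le_of_eq ?_)
  field_simp

theorem eq_zero_of_eq_volterra {g f : ℝ → ℂ} {M : ℝ} (hM : ∀ x, ‖g x‖ ≤ M)
    (hf : ContinuousOn f (Set.Icc 0 1)) (h : ∀ x ∈ Set.Icc (0 : ℝ) 1, f x = volterra g f x) :
    ∀ x ∈ Set.Icc (0 : ℝ) 1, f x = 0 := by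
  have hM0 : 0 ≤ M := (norm_nonneg _).trans (hM 0)
  -- This choice gives `M / k ^ 2 < 1`, so iterating the weighted estimate drives `f` to zero.
  set k : ℝ := M + 1
  have hk : 0 < k := by positivity
  have hr : M / k ^ 2 < 1 := by
    rw [div_lt_one (by positivity)]
    nlinarith
  have hr0 : 0 ≤ M / k ^ 2 := by positivity
  obtain ⟨c, hc⟩ := isCompact_Icc.exists_bound_of_continuousOn hf
  have hc0 : 0 ≤ c := (norm_nonneg _).trans (hc 0 (by simp))
  have hn : ∀ n : ℕ, ∀ x ∈ Set.Icc (0 : ℝ) 1,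
      ‖f x‖ ≤ (M / k ^ 2) ^ n * c * Real.exp (k * x) := by
    intro n
    induction n with
    | zero =>
      intro x hx
      have : 1 ≤ Real.exp (k * x) := Real.one_le_exp (mul_nonneg hk.le hx.1)
      have := hc x hx
      simp only [pow_zero, one_mul]
      nlinarith
    | succ n ih =>
      intro x hx
      rw [h x hx]
      refine (norm_volterra_le hM hM0 (by positivity) hk ih hx).trans (le_of_eq ?_)
      ring
  intro x hx
  have ht : Filter.Tendsto (fun n : ℕ => (M / k ^ 2) ^ n * c * Real.exp (k * x)) Filter.atTop
      (nhds (0 * c * Real.exp (k * x))) :=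
    ((tendsto_pow_atTop_nhds_zero_of_lt_one hr0 hr).mul_const _).mul_const _
  have := ge_of_tendsto' ht fun n => hn n x hx
  simpa using this

/-- Banach's fixed point theorem, applied to `z = exp (-k x) f`, whose plain sup norm is the
weighted norm of `f`. -/
theorem exists_eq_add_volterra {g : ℝ → ℂ} {M : ℝ}
    (hg : AEStronglyMeasurable g volume) (hM : ∀ x, ‖g x‖ ≤ M) {p : ℝ → ℂ} (hp : Continuous p) :
    ∃ f : ℝ → ℂ, Continuous f ∧ ∀ x ∈ Set.Icc (0 : ℝ) 1, f x = p x + volterra g f x := by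
  have hM0 : 0 ≤ M := (norm_nonneg _).trans (hM 0)
  set k : ℝ := M + 1
  have hk : 0 < k := by positivity
  have hr : M / k ^ 2 < 1 := by
    rw [div_lt_one (by positivity)]
    nlinarith
  have hr0 : 0 ≤ M / k ^ 2 := by positivity
  -- `E` undoes the weight, after extending `z` to the whole line by its end values.
  let E : C(Set.Icc (0 : ℝ) 1, ℂ) → ℝ → ℂ :=
    fun z x => (Real.exp (k * x) : ℂ) * z (Set.projIcc 0 1 zero_le_one x)
  have hE : ∀ z, Continuous (E z) := fun z => by
    have := continuous_projIcc (a := (0 : ℝ)) (b := 1) (h := zero_le_one)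
    fun_prop
  have hV : ∀ z, Continuous (volterra g (E z)) := fun z =>
    continuous_iff_continuousAt.2 fun x => (hasDerivAt_volterra hg hM (hE z) x).continuousAt
  let Ψ : C(Set.Icc (0 : ℝ) 1, ℂ) → C(Set.Icc (0 : ℝ) 1, ℂ) := fun z =>
    ⟨fun x => (Real.exp (-(k * x)) : ℂ) * (p x + volterra g (E z) x), by
      have := hV z
      fun_prop⟩
  have hΨ : ContractingWith ⟨M / k ^ 2, hr0⟩ Ψ := by
    refine ⟨hr, LipschitzWith.of_dist_le_mul fun z z' => ?_⟩
    rw [ContinuousMap.dist_le (by positivity)]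
    intro x
    have hsub : volterra g (E z) x - volterra g (E z') x = volterra g (E z - E z') x := by
      have h1 : ∀ t : ℝ, ∫ s in (0 : ℝ)..t, g s * (E z - E z') s =
          (∫ s in (0 : ℝ)..t, g s * E z s) - ∫ s in (0 : ℝ)..t, g s * E z' s := by
        intro t
        rw [← intervalIntegral.integral_sub
          (intervalIntegrable_mul_of_bounded hg hM (hE z) _ _)
          (intervalIntegrable_mul_of_bounded hg hM (hE z') _ _)]
        simp only [Pi.sub_apply, mul_sub]
      unfold volterra
      simp only [h1]
      rw [intervalIntegral.integral_sub
        ((continuous_primitive_mul hg hM (hE z)).intervalIntegrable _ _)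
        ((continuous_primitive_mul hg hM (hE z')).intervalIntegrable _ _)]
    have hb : ∀ x ∈ Set.Icc (0 : ℝ) 1, ‖(E z - E z') x‖ ≤ dist z z' * Real.exp (k * x) := by
      intro x _
      simp only [E, Pi.sub_apply, ← mul_sub]
      rw [norm_mul, Complex.norm_real, Real.norm_of_nonneg (Real.exp_pos _).le, mul_comm,
        ← dist_eq_norm]
      gcongr
      exact ContinuousMap.dist_apply_le_dist _
    have h2 := norm_volterra_le hM hM0 dist_nonneg hk hb x.2
    have h3 : Ψ z x - Ψ z' x =
        (Real.exp (-(k * x)) : ℂ) * volterra g (E z - E z') x := by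
      rw [← hsub]
      simp only [Ψ, ContinuousMap.coe_mk]
      ring
    rw [dist_eq_norm, h3, norm_mul, Complex.norm_real, Real.norm_of_nonneg (Real.exp_pos _).le,
      Real.exp_neg]
    calc (Real.exp (k * x))⁻¹ * ‖volterra g (E z - E z') x‖
        ≤ (Real.exp (k * x))⁻¹ * (M / k ^ 2 * dist z z' * Real.exp (k * x)) := by gcongr
      _ = M / k ^ 2 * dist z z' := by
        have := (Real.exp_pos (k * x)).ne'
        field_simp
  have hfix := hΨ.fixedPoint_isFixedPt
  set z := ContractingWith.fixedPoint Ψ hΨ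
  refine ⟨E z, hE z, fun x hx => ?_⟩
  have h1 : Ψ z ⟨x, hx⟩ = z ⟨x, hx⟩ := by rw [hfix.eq]
  have h2 : E z x = (Real.exp (k * x) : ℂ) * z ⟨x, hx⟩ := by
    simp only [E, Set.projIcc_of_mem _ hx]
  rw [h2, ← h1]
  simp only [Ψ, ContinuousMap.coe_mk]
  rw [← mul_assoc, ← Complex.ofReal_mul, ← Real.exp_add, add_neg_cancel, Real.exp_zero,
    Complex.ofReal_one, one_mul]

/-! ### Solutions of the Schrödinger equation on an edge -/

/-- The coefficient `q - lam` on `[0, 1]`, extended by zero. -/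
def pot (q : ℝ → ℝ) (lam : ℝ) : ℝ → ℂ :=
  Set.indicator (Set.Icc 0 1) fun x => ((q x - lam : ℝ) : ℂ)

/-- Boundedness and measurability of the coefficient `q - lam`. -/
def GoodPot (q : ℝ → ℝ) (lam : ℝ) : Prop :=
  AEStronglyMeasurable (pot q lam) volume ∧ ∃ M, ∀ x, ‖pot q lam x‖ ≤ M

theorem goodPot_of_bounded {q : ℝ → ℝ}
    (hq_meas : AEMeasurable q (volume.restrict (Set.Icc (0 : ℝ) 1)))
    (hq_bdd : ∃ C : ℝ, ∀ x ∈ Set.Icc (0 : ℝ) 1, -C < q x ∧ q x < C) (lam : ℝ) :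
    GoodPot q lam := by
  constructor
  · unfold pot
    rw [aestronglyMeasurable_indicator_iff measurableSet_Icc]
    exact (Complex.measurable_ofReal.comp_aemeasurable
      (hq_meas.sub_const lam)).aestronglyMeasurable
  · obtain ⟨C, hC⟩ := hq_bdd
    have hC0 : 0 ≤ C := by
      have := hC 0 (by simp)
      linarith
    refine ⟨C + |lam|, fun x => ?_⟩
    unfold pot
    by_cases hx : x ∈ Set.Icc (0 : ℝ) 1
    · rw [Set.indicator_of_mem hx, Complex.norm_real, Real.norm_eq_abs]
      have := hC x hx
      refine (abs_sub _ _).trans ?_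
      gcongr
      exact abs_le.2 ⟨this.1.le, this.2.le⟩
    · rw [Set.indicator_of_notMem hx, norm_zero]
      positivity

theorem D_congr {y z : ℝ → ℂ} (h : Set.EqOn y z (Set.Icc 0 1)) {x : ℝ}
    (hx : x ∈ Set.Icc (0 : ℝ) 1) : D y x = D z x :=
  derivWithin_congr h (h hx)

theorem D_eq_of_hasDerivWithinAt {y : ℝ → ℂ} {d : ℂ} {x : ℝ} (hx : x ∈ Set.Icc (0 : ℝ) 1)
    (h : HasDerivWithinAt y d (Set.Icc 0 1) x) : D y x = d :=
  h.derivWithin (uniqueDiffOn_Icc zero_lt_one x hx)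

theorem integral_pot_mul_congr {q : ℝ → ℝ} {lam : ℝ} {y z : ℝ → ℂ}
    (h : Set.EqOn y z (Set.Icc 0 1)) {a x : ℝ} :
    ∫ t in a..x, pot q lam t * y t = ∫ t in a..x, pot q lam t * z t := by
  congr 1
  funext t
  by_cases ht : t ∈ Set.Icc (0 : ℝ) 1
  · rw [h ht]
  · simp [pot, Set.indicator_of_notMem ht]

theorem exists_continuous_eqOn {y : ℝ → ℂ} (h : ContinuousOn y (Set.Icc 0 1)) :
    ∃ z : ℝ → ℂ, Continuous z ∧ Set.EqOn y z (Set.Icc 0 1) :=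
  ⟨Set.IccExtend zero_le_one ((Set.Icc (0 : ℝ) 1).domRestrict y),
    (continuousOn_iff_continuous_domRestrict.1 h).Icc_extend', fun x hx => by
      rw [Set.IccExtend_of_mem _ _ hx]
      rfl⟩

/-- Eliminates the weak second derivative: the equation forces it to be `pot q lam * y` almost
everywhere, and this product is bounded, hence square-integrable. -/
theorem solvesODE_iff {q : ℝ → ℝ} {lam : ℝ} (hq : GoodPot q lam) {y : ℝ → ℂ} :
    SolvesODE q lam y ↔ DifferentiableOn ℝ y (Set.Icc 0 1) ∧
      ∀ x ∈ Set.Icc (0 : ℝ) 1, D y x = D y 0 + ∫ t in (0 : ℝ)..x, pot q lam t * y t := by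
  obtain ⟨hm, M, hM⟩ := hq
  constructor
  · rintro ⟨y₂, h, h'⟩
    refine ⟨h.diff, fun x hx => ?_⟩
    rw [h.eq_integral x hx]
    congr 1
    refine intervalIntegral.integral_congr_ae ?_
    rw [Set.uIoc_of_le hx.1]
    rw [ae_restrict_iff' measurableSet_Ioo] at h'
    have h1 : ∀ᵐ t : ℝ, t ≠ 1 := by simp [ae_iff]
    filter_upwards [h', h1] with t ht ht1 ht2
    have h3 : t ∈ Set.Ioo (0 : ℝ) 1 := ⟨ht2.1, lt_of_le_of_ne (ht2.2.trans hx.2) ht1⟩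
    have := ht h3
    rw [pot, Set.indicator_of_mem (Set.Ioo_subset_Icc_self h3)]
    push_cast
    linear_combination -this
  · rintro ⟨hd, h⟩
    obtain ⟨z, hz, hyz⟩ := exists_continuous_eqOn hd.continuousOn
    refine ⟨fun t => pot q lam t * z t, ⟨hd, ?_, fun x hx => ?_⟩, ?_⟩
    · obtain ⟨c, hc⟩ := (isCompact_Icc (a := (0 : ℝ)) (b := 1)).exists_bound_of_continuousOn
        hz.continuousOn
      refine MemLp.of_bound (hm.mul hz.aestronglyMeasurable).restrict (M * c) ?_
      refine (ae_restrict_iff' measurableSet_Ioo).2 (Filter.Eventually.of_forall fun t ht => ?_)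
      rw [norm_mul]
      exact mul_le_mul (hM t) (hc t (Set.Ioo_subset_Icc_self ht)) (norm_nonneg _)
        ((norm_nonneg _).trans (hM t))
    · rw [h x hx, integral_pot_mul_congr hyz]
    · refine (ae_restrict_iff' measurableSet_Ioo).2 (Filter.Eventually.of_forall fun t ht => ?_)
      have ht' := Set.Ioo_subset_Icc_self ht
      simp only [pot, Set.indicator_of_mem ht', hyz ht']
      push_cast
      ring

theorem SolvesODE.congr {q : ℝ → ℝ} {lam : ℝ} (hq : GoodPot q lam) {y z : ℝ → ℂ}
    (h : Set.EqOn y z (Set.Icc 0 1)) (hy : SolvesODE q lam y) : SolvesODE q lam z := by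
  rw [solvesODE_iff hq] at hy ⊢
  refine ⟨hy.1.congr fun x hx => (h hx).symm, fun x hx => ?_⟩
  rw [← D_congr h hx, ← D_congr h (by simp), ← integral_pot_mul_congr h]
  exact hy.2 x hx

theorem SolvesODE.eq_add_volterra {q : ℝ → ℝ} {lam : ℝ} (hq : GoodPot q lam) {y : ℝ → ℂ}
    (hy : SolvesODE q lam y) {x : ℝ} (hx : x ∈ Set.Icc (0 : ℝ) 1) :
    y x = y 0 + D y 0 * x + volterra (pot q lam) y x := by
  rw [solvesODE_iff hq] at hy
  obtain ⟨hd, h⟩ := hy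
  obtain ⟨hm, M, hM⟩ := hq
  obtain ⟨z, hz, hyz⟩ := exists_continuous_eqOn hd.continuousOn
  have hc := continuous_primitive_mul hm hM hz
  have h1 : ∫ t in (0 : ℝ)..x, (D y 0 + ∫ s in (0 : ℝ)..t, pot q lam s * z s) = y x - y 0 := by
    refine intervalIntegral.integral_eq_sub_of_hasDerivAt_of_le hx.1
      (hd.continuousOn.mono (Set.Icc_subset_Icc_right hx.2)) (fun t ht => ?_)
      (Continuous.intervalIntegrable (by fun_prop) _ _)
    have ht' : t ∈ Set.Ioo (0 : ℝ) 1 := ⟨ht.1, ht.2.trans_le hx.2⟩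
    have := (hd t (Set.Ioo_subset_Icc_self ht')).hasDerivWithinAt.hasDerivAt
      (Icc_mem_nhds ht'.1 ht'.2)
    rw [← integral_pot_mul_congr hyz, ← h t (Set.Ioo_subset_Icc_self ht')]
    exact this
  rw [intervalIntegral.integral_add (by simp) (hc.intervalIntegrable _ _)] at h1
  simp only [← integral_pot_mul_congr hyz, intervalIntegral.integral_const, sub_zero,
    Complex.real_smul] at h1
  unfold volterra
  linear_combination -h1

theorem SolvesODE.eq_zero {q : ℝ → ℝ} {lam : ℝ} (hq : GoodPot q lam) {y : ℝ → ℂ}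
    (hy : SolvesODE q lam y) (h0 : y 0 = 0) (h1 : D y 0 = 0) :
    ∀ x ∈ Set.Icc (0 : ℝ) 1, y x = 0 := by
  obtain ⟨-, M, hM⟩ := id hq
  refine eq_zero_of_eq_volterra hM hy.diff.continuousOn fun x hx => ?_
  rw [hy.eq_add_volterra hq hx, h0, h1]
  ring

theorem exists_solvesODE {q : ℝ → ℝ} {lam : ℝ} (hq : GoodPot q lam) (a b : ℂ) :
    ∃ y, SolvesODE q lam y ∧ y 0 = a ∧ D y 0 = b := by
  obtain ⟨hm, M, hM⟩ := id hq
  obtain ⟨f, hf, hfe⟩ := exists_eq_add_volterra hm hM (p := fun x : ℝ => a + b * x) (by fun_prop)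
  let y : ℝ → ℂ := fun x => a + b * x + volterra (pot q lam) f x
  have hfy : Set.EqOn f y (Set.Icc 0 1) := hfe
  have hy : ∀ x, HasDerivAt y (b + ∫ s in (0 : ℝ)..x, pot q lam s * f s) x := fun x => by
    have h1 : HasDerivAt (fun x : ℝ => a + b * (x : ℂ)) b x := by
      simpa using ((hasDerivAt_id x).ofReal_comp.const_mul b).const_add a
    exact h1.add (hasDerivAt_volterra hm hM hf x)
  have hD : ∀ x ∈ Set.Icc (0 : ℝ) 1, D y x = b + ∫ s in (0 : ℝ)..x, pot q lam s * f s :=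
    fun x hx => D_eq_of_hasDerivWithinAt hx (hy x).hasDerivWithinAt
  have hD0 : D y 0 = b := by rw [hD 0 (by simp)]; simp
  refine ⟨y, (solvesODE_iff hq).2 ⟨fun x _ => (hy x).differentiableAt.differentiableWithinAt,
    fun x hx => ?_⟩, by simp [y, volterra], hD0⟩
  rw [hD x hx, hD0, integral_pot_mul_congr hfy]

theorem SolvesODE.conj {q : ℝ → ℝ} {lam : ℝ} (hq : GoodPot q lam) {y : ℝ → ℂ}
    (hy : SolvesODE q lam y) : SolvesODE q lam (fun x => conj (y x)) ∧
      ∀ x ∈ Set.Icc (0 : ℝ) 1, D (fun x => conj (y x)) x = conj (D y x) := by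
  have hd : ∀ x ∈ Set.Icc (0 : ℝ) 1,
      HasDerivWithinAt (fun x => conj (y x)) (conj (D y x)) (Set.Icc 0 1) x := fun x hx =>
    Complex.conjCLE.toContinuousLinearMap.hasFDerivAt.comp_hasDerivWithinAt x
      (hy.diff x hx).hasDerivWithinAt
  have hD := fun x hx => D_eq_of_hasDerivWithinAt hx (hd x hx)
  refine ⟨(solvesODE_iff hq).2 ⟨fun x hx => (hd x hx).differentiableWithinAt, fun x hx => ?_⟩, hD⟩
  rw [hD x hx, hD 0 (by simp), ((solvesODE_iff hq).1 hy).2 x hx, map_add]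
  congr 1
  rw [← intervalIntegral.intervalIntegral_conj]
  congr 1
  funext t
  rw [map_mul]
  congr 1
  by_cases ht : t ∈ Set.Icc (0 : ℝ) 1
  · rw [pot, Set.indicator_of_mem ht, Complex.conj_ofReal]
  · simp [pot, Set.indicator_of_notMem ht]

theorem pot_one_sub {q : ℝ → ℝ} {lam : ℝ} (hs : ∀ x ∈ Set.Icc (0 : ℝ) 1, q (1 - x) = q x)
    (t : ℝ) : pot q lam (1 - t) = pot q lam t := by
  unfold pot
  by_cases ht : t ∈ Set.Icc (0 : ℝ) 1
  · have ht' : 1 - t ∈ Set.Icc (0 : ℝ) 1 := ⟨by linarith [ht.2], by linarith [ht.1]⟩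
    rw [Set.indicator_of_mem ht, Set.indicator_of_mem ht', hs t ht]
  · have ht' : 1 - t ∉ Set.Icc (0 : ℝ) 1 := fun h => ht ⟨by linarith [h.2], by linarith [h.1]⟩
    rw [Set.indicator_of_notMem ht, Set.indicator_of_notMem ht']

/-- The symmetry of `q` enters only here; it makes the two ends of an edge interchangeable. -/
theorem SolvesODE.reflect {q : ℝ → ℝ} {lam : ℝ} (hq : GoodPot q lam)
    (hs : ∀ x ∈ Set.Icc (0 : ℝ) 1, q (1 - x) = q x) {y : ℝ → ℂ}
    (hy : SolvesODE q lam y) : SolvesODE q lam (fun x => y (1 - x)) ∧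
      ∀ x ∈ Set.Icc (0 : ℝ) 1, D (fun x => y (1 - x)) x = -D y (1 - x) := by
  have hmem : ∀ x ∈ Set.Icc (0 : ℝ) 1, 1 - x ∈ Set.Icc (0 : ℝ) 1 := fun x hx =>
    ⟨by linarith [hx.2], by linarith [hx.1]⟩
  have hd : ∀ x ∈ Set.Icc (0 : ℝ) 1,
      HasDerivWithinAt (fun x => y (1 - x)) (-D y (1 - x)) (Set.Icc 0 1) x := fun x hx => by
    have h1 : HasDerivWithinAt (fun x : ℝ => 1 - x) (-1) (Set.Icc 0 1) x :=
      ((hasDerivAt_id x).const_sub 1).hasDerivWithinAt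
    rw [← neg_one_smul ℝ]
    exact (hy.diff _ (hmem x hx)).hasDerivWithinAt.scomp x h1 hmem
  have hD := fun x hx => D_eq_of_hasDerivWithinAt hx (hd x hx)
  refine ⟨(solvesODE_iff hq).2 ⟨fun x hx => (hd x hx).differentiableWithinAt, fun x hx => ?_⟩, hD⟩
  have h := ((solvesODE_iff hq).1 hy).2
  obtain ⟨hm, M, hM⟩ := hq
  obtain ⟨z, hz, hyz⟩ := exists_continuous_eqOn hy.diff.continuousOn
  rw [hD x hx, hD 0 (by simp), h _ (hmem x hx), sub_zero, h 1 (by simp)]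
  have h1 : ∫ t in (0 : ℝ)..x, pot q lam t * y (1 - t) = ∫ t in (1 - x)..1, pot q lam t * y t := by
    have := intervalIntegral.integral_comp_sub_left (a := 0) (b := x)
      (fun t => pot q lam t * y t) 1
    simp only [sub_zero] at this
    rw [← this]
    congr 1
    funext t
    rw [pot_one_sub hs]
  rw [h1]
  have hi := intervalIntegrable_mul_of_bounded hm hM hz
  have h2 := intervalIntegral.integral_add_adjacent_intervals (hi 0 (1 - x)) (hi (1 - x) 1)
  simp only [← integral_pot_mul_congr hyz] at h2
  linear_combination -h2

/-- The boundary value problem on an edge, when `lam` is not a Dirichlet eigenvalue: it is uniquely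
solvable, and the boundary derivatives are given by a symmetric real Dirichlet-to-Neumann
matrix with nonzero off-diagonal entries. -/
theorem exists_dirichletToNeumann {q : ℝ → ℝ} {lam : ℝ} (hq : GoodPot q lam)
    (hs : ∀ x ∈ Set.Icc (0 : ℝ) 1, q (1 - x) = q x) (hlam : lam ∉ dirichletSpectrum q) :
    ∃ A B : ℝ, B ≠ 0 ∧
      (∀ y, SolvesODE q lam y → D y 0 = A * y 0 + B * y 1 ∧ D y 1 = -(B * y 0) - A * y 1) ∧
      (∀ a b : ℂ, ∃ y, SolvesODE q lam y ∧ y 0 = a ∧ y 1 = b) ∧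
      (∀ y, SolvesODE q lam y → y 0 = 0 → y 1 = 0 → ∀ x ∈ Set.Icc (0 : ℝ) 1, y x = 0) := by
  obtain ⟨c, hc, hc0, hc1⟩ := exists_solvesODE hq 1 0
  obtain ⟨s, hs', hs0, hs1⟩ := exists_solvesODE hq 0 1
  have h01 : (0 : ℝ) ∈ Set.Icc (0 : ℝ) 1 := by simp
  have h11 : (1 : ℝ) ∈ Set.Icc (0 : ℝ) 1 := by simp
  have hsne : s 1 ≠ 0 := fun h => hlam ⟨s, hs', hs0, hs1, h⟩
  have hgen : ∀ y, SolvesODE q lam y → ∀ x ∈ Set.Icc (0 : ℝ) 1,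
      y x = y 0 * c x + D y 0 * s x := by
    intro y hy x hx
    have h1 := (hc.smul (y 0)).add (hs'.smul (D y 0))
    have h2 := hy.add (h1.smul (-1))
    have h3 := h2.eq_zero hq (by simp [hc0, hs0]) (by
      rw [D_add hy.diff (h1.smul (-1)).diff h01, D_smul _ h1.diff h01,
        D_add (hc.smul _).diff (hs'.smul _).diff h01, D_smul _ hc.diff h01,
        D_smul _ hs'.diff h01, hc1, hs1]
      ring) x hx
    simp only [Pi.add_apply, Pi.smul_apply, smul_eq_mul] at h3
    linear_combination h3
  -- The potential is real, so the conjugate solves the same equation; with real initial data it is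
  -- the same solution.
  have hreal : ∀ y, SolvesODE q lam y → conj (y 0) = y 0 → conj (D y 0) = D y 0 →
      conj (y 1) = y 1 := by
    intro y hy h0 h1
    have h2 := hgen _ (hy.conj hq).1 1 h11
    rw [(hy.conj hq).2 0 h01] at h2
    simp only [h0, h1] at h2
    rw [h2, hgen y hy 1 h11]
  obtain ⟨C, hC⟩ := Complex.conj_eq_iff_real.1 (hreal c hc (by simp [hc0]) (by simp [hc1]))
  obtain ⟨S, hS⟩ := Complex.conj_eq_iff_real.1 (hreal s hs' (by simp [hs0]) (by simp [hs1]))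
  rw [hS] at hsne
  -- Solve `y 1 = C * y 0 + S * D y 0` for the derivative; `S ≠ 0` is the hypothesis on the
  -- Dirichlet spectrum.
  have hfst : ∀ y, SolvesODE q lam y → D y 0 = (-(C / S) : ℝ) * y 0 + (1 / S : ℝ) * y 1 := by
    intro y hy
    have := hgen y hy 1 h11
    rw [hC, hS] at this
    push_cast
    field_simp
    linear_combination -this
  refine ⟨-(C / S), 1 / S, one_div_ne_zero (by exact_mod_cast hsne),
    fun y hy => ⟨hfst y hy, ?_⟩, fun a b => ?_, fun y hy h0 h1 => ?_⟩
  -- The formula at `1` is the formula at `0` for the reflected solution.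
  · obtain ⟨h1, h2⟩ := hy.reflect hq hs
    have h3 := hfst _ h1
    rw [h2 0 h01] at h3
    simp only [sub_zero, sub_self] at h3
    linear_combination -h3
  · refine ⟨_, (hc.smul a).add (hs'.smul ((b - a * c 1) / s 1)), by simp [hc0, hs0], ?_⟩
    have : s 1 ≠ 0 := by rwa [hS]
    simp only [Pi.add_apply, Pi.smul_apply, smul_eq_mul]
    field_simp
    ring
  · refine hy.eq_zero hq h0 ?_
    rw [hfst y hy, h0, h1]
    ring

/-! ### The height on the symmetry group -/

section Group

variable {α β δ : ℕ}

/-- The height `β m - α n` of `(m, n)` over the line around the tube. -/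
def height (α β δ : ℕ) : G α β δ →+ ℤ :=
  QuotientAddGroup.lift _
    ((β : ℤ) • AddMonoidHom.fst ℤ ℤ - (α : ℤ) • AddMonoidHom.snd ℤ ℤ) (by
      intro x hx
      obtain ⟨k, rfl⟩ := AddSubgroup.mem_zmultiples_iff.1 hx
      simp only [AddMonoidHom.mem_ker, map_zsmul]
      simp
      right
      ring)

theorem height_vtx (m n : ℤ) : height α β δ (vtx α β δ m n) = β * m - α * n := by
  simp [height, vtx]

theorem height_hh : height α β δ (hh α β δ) = β := by simp [hh, height_vtx]

theorem height_vv : height α β δ (vv α β δ) = -α := by simp [vv, height_vtx]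

theorem exists_vtx_eq (p : G α β δ) : ∃ m n : ℤ, p = vtx α β δ m n := by
  obtain ⟨⟨m, n⟩, rfl⟩ := QuotientAddGroup.mk_surjective p
  exact ⟨m, n, rfl⟩

/-- With `y α + x β = 1`, the change of coordinates `(m, n) ↦ (β m - α n, y m + x n)` has
determinant `1` and sends `(αδ, βδ)` to `(0, δ)`, so only the second coordinate is reduced modulo
`δ`. -/
theorem exists_equiv_height (hαβ : Nat.Coprime α β) :
    ∃ e : G α β δ ≃ ℤ × ZMod δ, ∀ p, (e p).1 = height α β δ p := by
  obtain ⟨y, x, hxy⟩ := Nat.isCoprime_iff_coprime.2 hαβ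
  let c : G α β δ →+ ZMod δ :=
    QuotientAddGroup.lift _ ((Int.castAddHom (ZMod δ)).comp
      (x • AddMonoidHom.snd ℤ ℤ + y • AddMonoidHom.fst ℤ ℤ)) (by
        intro z hz
        obtain ⟨k, rfl⟩ := AddSubgroup.mem_zmultiples_iff.1 hz
        rw [AddMonoidHom.mem_ker, map_zsmul]
        simp)
  have hc : ∀ m n : ℤ, c (vtx α β δ m n) = ((x * n + y * m : ℤ) : ZMod δ) := by
    intro m n
    simp [c, vtx]
  refine ⟨Equiv.ofBijective (fun p => (height α β δ p, c p)) ⟨?_, ?_⟩, fun p => rfl⟩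
  · intro p p' h
    simp only [Prod.mk.injEq] at h
    rw [← sub_eq_zero, ← map_sub, ← sub_eq_zero (a := c p), ← map_sub] at h
    rw [← sub_eq_zero]
    obtain ⟨m, n, hp⟩ := exists_vtx_eq (p - p')
    rw [hp, height_vtx, hc, ZMod.intCast_zmod_eq_zero_iff_dvd] at h
    obtain ⟨h1, k, hk⟩ := h
    rw [hp, vtx, QuotientAddGroup.eq_zero_iff, AddSubgroup.mem_zmultiples_iff]
    refine ⟨k, ?_⟩
    simp only [Prod.smul_mk, smul_eq_mul, Prod.mk.injEq]
    push_cast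
    constructor
    · linear_combination (-(α : ℤ)) * hk + m * hxy - x * h1
    · linear_combination (-(β : ℤ)) * hk + n * hxy + y * h1
  · rintro ⟨r, s⟩
    obtain ⟨s, rfl⟩ := ZMod.intCast_surjective s
    refine ⟨vtx α β δ (r * x + s * α) (-(r * y) + s * β), ?_⟩
    simp only [height_vtx, hc, Prod.mk.injEq]
    constructor
    · linear_combination r * hxy
    · congr 1
      linear_combination s * hxy

theorem ncard_height_Ioc (hαβ : Nat.Coprime α β) (hδ : 1 ≤ δ) (a b : ℤ) :
    {p : G α β δ | height α β δ p ∈ Set.Ioc a b}.Finite ∧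
      {p : G α β δ | height α β δ p ∈ Set.Ioc a b}.ncard = (b - a).toNat * δ := by
  have : NeZero δ := ⟨by omega⟩
  obtain ⟨e, he⟩ := exists_equiv_height (δ := δ) hαβ
  have h1 : {p : G α β δ | height α β δ p ∈ Set.Ioc a b} =
      e.symm '' (Set.Ioc a b ×ˢ (Set.univ : Set (ZMod δ))) := by
    rw [Equiv.image_symm_eq_preimage]
    ext p
    simp [he]
  rw [h1]
  refine ⟨((Set.finite_Ioc a b).prod Set.finite_univ).image _, ?_⟩
  rw [Set.ncard_image_of_injective _ e.symm.injective, Set.ncard_prod, Set.ncard_univ,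
    Nat.card_zmod, ← Finset.coe_Ioc, Set.ncard_coe_finset, Int.card_Ioc]

/-- An edge that meets the line at parameter `t` starts at height `-β t` if it points right and `-α
t` if it points down, with `0 ≤ t < 1`. -/
theorem mem_crossing (hα : 0 < α) (hlt : α < β) (e : Edge α β δ) :
    e ∈ crossing α β δ ↔ (-(β : ℤ) < height α β δ e.1 ∧ height α β δ e.1 ≤ 0 ∧ e.2 = Dir.right) ∨
      (-(α : ℤ) < height α β δ e.1 ∧ height α β δ e.1 ≤ 0 ∧ e.2 = Dir.down) := by
  have hα' : (0 : ℝ) < α := by exact_mod_cast hα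
  have hβ' : (0 : ℝ) < β := by exact_mod_cast hα.trans hlt
  have hr : ∀ m n : ℤ, MeetsLine α β m n Dir.right ↔
      -(β : ℤ) < β * m - α * n ∧ (β : ℤ) * m - α * n ≤ 0 := by
    intro m n
    have h1 : (-(β : ℤ) < β * m - α * n ↔ -(β : ℝ) < β * m - α * n) := by
      rw [← Int.cast_lt (R := ℝ)]
      push_cast
      rfl
    have h2 : ((β : ℤ) * m - α * n ≤ 0 ↔ (β : ℝ) * m - α * n ≤ 0) := by
      rw [← Int.cast_le (R := ℝ)]
      push_cast
      rfl
    rw [h1, h2]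
    constructor
    · rintro ⟨t, ht, h⟩
      constructor <;> nlinarith [ht.1, ht.2]
    · rintro ⟨h1, h2⟩
      refine ⟨(α * n - β * m) / β, ⟨by apply div_nonneg <;> linarith, ?_⟩, ?_⟩
      · rw [div_lt_one hβ']
        linarith
      · field_simp
        ring
  have hd : ∀ m n : ℤ, MeetsLine α β m n Dir.down ↔
      -(α : ℤ) < β * m - α * n ∧ (β : ℤ) * m - α * n ≤ 0 := by
    intro m n
    have h1 : (-(α : ℤ) < β * m - α * n ↔ -(α : ℝ) < β * m - α * n) := by
      rw [← Int.cast_lt (R := ℝ)]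
      push_cast
      rfl
    have h2 : ((β : ℤ) * m - α * n ≤ 0 ↔ (β : ℝ) * m - α * n ≤ 0) := by
      rw [← Int.cast_le (R := ℝ)]
      push_cast
      rfl
    rw [h1, h2]
    constructor
    · rintro ⟨t, ht, h⟩
      constructor <;> nlinarith [ht.1, ht.2]
    · rintro ⟨h1, h2⟩
      refine ⟨(α * n - β * m) / α, ⟨by apply div_nonneg <;> linarith, ?_⟩, ?_⟩
      · rw [div_lt_one hα']
        linarith
      · field_simp
        ring
  obtain ⟨p, d⟩ := e
  constructor
  · rintro ⟨m, n, hp, h⟩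
    simp only at hp h
    subst hp
    cases d
    · have := (hr m n).1 h
      simp [height_vtx] at this ⊢
      exact this
    · have := (hd m n).1 h
      simp [height_vtx] at this ⊢
      exact this
  · intro h
    obtain ⟨m, n, rfl⟩ := exists_vtx_eq p
    refine ⟨m, n, rfl, ?_⟩
    cases d
    · rw [hr]
      simpa [height_vtx] using h
    · rw [hd]
      simpa [height_vtx] using h

/-- The rightward edges have sources in `(-β, 0]` and targets in `(0, β]`. The downward edges join
`(-α, 0]` to `(0, α]` and add nothing, since `α < β`. -/
theorem mem_V0 (hα : 0 < α) (hlt : α < β) (p : G α β δ) :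
    p ∈ V0 α β δ ↔ -(β : ℤ) < height α β δ p ∧ height α β δ p ≤ β := by
  constructor
  · rintro ⟨⟨p', d⟩, he, h⟩
    rw [mem_crossing hα hlt] at he
    cases d
    · simp [Edge.src, Edge.tgt] at he h
      rcases h with rfl | rfl
      · omega
      · rw [map_add, height_hh]
        omega
    · simp [Edge.src, Edge.tgt] at he h
      rcases h with rfl | rfl
      · omega
      · rw [map_sub, height_vv]
        omega
  · intro h
    by_cases h0 : height α β δ p ≤ 0
    · exact ⟨(p, Dir.right), (mem_crossing hα hlt _).2 (Or.inl ⟨h.1, h0, rfl⟩), Or.inl rfl⟩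
    · refine ⟨(p - hh α β δ, Dir.right), (mem_crossing hα hlt _).2 (Or.inl ⟨?_, ?_, rfl⟩),
        Or.inr (by simp [Edge.tgt])⟩
      · simp only [map_sub, height_hh]
        omega
      · simp only [map_sub, height_hh]
        omega

theorem finite_V0 (hαβ : Nat.Coprime α β) (hα : 0 < α) (hlt : α < β) (hδ : 1 ≤ δ) :
    Finite (V0 α β δ) ∧ Nat.card (V0 α β δ) = 2 * (β * δ) := by
  have h : V0 α β δ = {p : G α β δ | height α β δ p ∈ Set.Ioc (-(β : ℤ)) β} := by
    ext p
    exact mem_V0 hα hlt p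
  rw [Nat.card_coe_set_eq, h]
  obtain ⟨h1, h2⟩ := ncard_height_Ioc (δ := δ) hαβ hδ (-(β : ℤ)) β
  refine ⟨h1.to_subtype, h2.trans ?_⟩
  have : ((β : ℤ) - -(β : ℤ)).toNat = 2 * β := by omega
  rw [this]
  ring

/-! ### Solutions of the difference equation -/

/-- The difference equation satisfied by the vertex values of functions in `V_lam`. -/
def IsDiscrete (κ : ℂ) (f : G α β δ → ℂ) : Prop :=
  ∀ p, f (p + hh α β δ) + f (p - hh α β δ) + f (p + vv α β δ) + f (p - vv α β δ) = κ * f p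

open Classical in
/-- The solution of the difference equation with prescribed values on `𝒱₀`. -/
def discreteExt (hα : 0 < α) (hlt : α < β) (κ : ℂ) (g : V0 α β δ → ℂ) (p : G α β δ) : ℂ :=
  if hp : p ∈ V0 α β δ then g ⟨p, hp⟩
  else if 0 < height α β δ p then
    κ * discreteExt hα hlt κ g (p - hh α β δ)
      - discreteExt hα hlt κ g (p - hh α β δ - hh α β δ)
      - discreteExt hα hlt κ g (p - hh α β δ + vv α β δ)
      - discreteExt hα hlt κ g (p - hh α β δ - vv α β δ)
  else
    κ * discreteExt hα hlt κ g (p + hh α β δ)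
      - discreteExt hα hlt κ g (p + hh α β δ + hh α β δ)
      - discreteExt hα hlt κ g (p + hh α β δ + vv α β δ)
      - discreteExt hα hlt κ g (p + hh α β δ - vv α β δ)
-- Twice the distance to `1/2`, the centre of the band `(-β, β]`. The plain absolute height would
-- not do: from height `-β` the recursion reaches height `β`.
termination_by (2 * height α β δ p - 1).natAbs
decreasing_by
  all_goals
    rw [mem_V0 hα hlt] at hp
    simp only [map_add, map_sub, height_hh, height_vv]
    omega

theorem discreteExt_of_mem (hα : 0 < α) (hlt : α < β) (κ : ℂ) (g : V0 α β δ → ℂ)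
    (p : V0 α β δ) : discreteExt hα hlt κ g p = g p := by
  rw [discreteExt, dif_pos p.2]

/-- The equation at `p` is the recursion that defines the value at `p + h` if `p` has positive
height, and at `p - h` otherwise; that vertex always lies outside `𝒱₀`. -/
theorem isDiscrete_discreteExt (hα : 0 < α) (hlt : α < β) (κ : ℂ) (g : V0 α β δ → ℂ) :
    IsDiscrete κ (discreteExt hα hlt κ g) := by
  intro p
  by_cases h0 : 0 < height α β δ p
  · have h : discreteExt hα hlt κ g (p + hh α β δ) = _ := discreteExt.eq_1 ..
    rw [dif_neg (by rw [mem_V0 hα hlt, map_add, height_hh]; omega),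
      if_pos (by rw [map_add, height_hh]; omega)] at h
    simp only [add_sub_cancel_right] at h
    rw [h]
    ring
  · have h : discreteExt hα hlt κ g (p - hh α β δ) = _ := discreteExt.eq_1 ..
    rw [dif_neg (by rw [mem_V0 hα hlt, map_sub, height_hh]; omega),
      if_neg (by rw [map_sub, height_hh]; omega)] at h
    simp only [sub_add_cancel] at h
    rw [h]
    ring

theorem IsDiscrete.eq_zero (hα : 0 < α) (hlt : α < β) {κ : ℂ} {f : G α β δ → ℂ}
    (hf : IsDiscrete κ f) (h0 : ∀ p ∈ V0 α β δ, f p = 0) (p : G α β δ) : f p = 0 := by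
  induction hn : (2 * height α β δ p - 1).natAbs using Nat.strong_induction_on generalizing p with
  | _ n ih =>
    by_cases hp : p ∈ V0 α β δ
    · exact h0 p hp
    have hp' := hp
    rw [mem_V0 hα hlt] at hp'
    by_cases hpos : 0 < height α β δ p
    · have h := hf (p - hh α β δ)
      rw [ih _ (by simp only [map_sub, height_hh]; omega) (p - hh α β δ) rfl,
        ih _ (by simp only [map_sub, height_hh]; omega) (p - hh α β δ - hh α β δ) rfl,
        ih _ (by simp only [map_sub, map_add, height_hh, height_vv]; omega)
          (p - hh α β δ + vv α β δ) rfl,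
        ih _ (by simp only [map_sub, height_hh, height_vv]; omega)
          (p - hh α β δ - vv α β δ) rfl, sub_add_cancel] at h
      simpa using h
    · have h := hf (p + hh α β δ)
      rw [ih _ (by simp only [map_add, height_hh]; omega) (p + hh α β δ) rfl,
        ih _ (by simp only [map_add, height_hh]; omega) (p + hh α β δ + hh α β δ) rfl,
        ih _ (by simp only [map_add, height_hh, height_vv]; omega)
          (p + hh α β δ + vv α β δ) rfl,
        ih _ (by simp only [map_sub, map_add, height_hh, height_vv]; omega)
          (p + hh α β δ - vv α β δ) rfl, add_sub_cancel_right] at h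
      simpa using h

/-! ### The discrete flux -/

open Classical in
/-- The vertices whose height lies in `(a, b]`. -/
def band (α β δ : ℕ) (a b : ℤ) : Finset (G α β δ) :=
  if h : {p : G α β δ | height α β δ p ∈ Set.Ioc a b}.Finite then h.toFinset else ∅

theorem mem_band (hαβ : Nat.Coprime α β) (hδ : 1 ≤ δ) {a b : ℤ} {p : G α β δ} :
    p ∈ band α β δ a b ↔ a < height α β δ p ∧ height α β δ p ≤ b := by
  rw [band, dif_pos (ncard_height_Ioc hαβ hδ a b).1]
  simp

theorem sum_band_add (hαβ : Nat.Coprime α β) (hδ : 1 ≤ δ) (φ : G α β δ → ℂ) {a b c : ℤ}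
    (hab : a ≤ b) (hbc : b ≤ c) :
    ∑ p ∈ band α β δ a b, φ p + ∑ p ∈ band α β δ b c, φ p = ∑ p ∈ band α β δ a c, φ p := by
  classical
  rw [← Finset.sum_union]
  · congr 1
    ext p
    simp only [Finset.mem_union, mem_band hαβ hδ]
    omega
  · rw [Finset.disjoint_left]
    intro p
    simp only [mem_band hαβ hδ]
    omega

theorem sum_band_shift (hαβ : Nat.Coprime α β) (hδ : 1 ≤ δ) (φ : G α β δ → ℂ) {a b a' b' : ℤ}
    (g : G α β δ) (ha : a' = a + height α β δ g) (hb : b' = b + height α β δ g) :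
    ∑ p ∈ band α β δ a b, φ (p + g) = ∑ p ∈ band α β δ a' b', φ p := by
  refine Finset.sum_nbij' (fun p => p + g) (fun p => p - g) ?_ ?_ ?_ ?_ ?_
  · intro p
    simp only [mem_band hαβ hδ, map_add]
    omega
  · intro p
    simp only [mem_band hαβ hδ, map_sub]
    omega
  · intro p _
    simp
  · intro p _
    simp
  · intro p _
    rfl

/-- The flow of a divergence-free field on the edges through the loop around the tube does not
change when the loop is shifted. -/
theorem flow_shift (hαβ : Nat.Coprime α β) (hlt : α < β) (hδ : 1 ≤ δ)
    {φ ψ : G α β δ → ℂ}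
    (h : ∀ p, φ p - φ (p - hh α β δ) + ψ p - ψ (p + vv α β δ) = 0) :
    ∑ p ∈ band α β δ (-β) 0, φ (p + hh α β δ) + ∑ p ∈ band α β δ (-α) 0, ψ (p + hh α β δ) =
      ∑ p ∈ band α β δ (-β) 0, φ p + ∑ p ∈ band α β δ (-α) 0, ψ p := by
  -- Sum the divergence over heights `(0, β]`. The terms in `ψ` then run over `(0, β]` and `(-α, β -
  -- α]`; their overlap `(0, β - α]` cancels.
  have h1 : ∑ p ∈ band α β δ 0 β, (φ p - φ (p - hh α β δ) + ψ p - ψ (p + vv α β δ)) = 0 :=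
    Finset.sum_eq_zero fun p _ => h p
  simp only [sub_eq_add_neg (φ _), Finset.sum_add_distrib, Finset.sum_sub_distrib,
    Finset.sum_neg_distrib] at h1
  rw [sum_band_shift hαβ hδ φ (a' := 0) (b' := β) (hh α β δ) (by rw [height_hh]; ring)
      (by rw [height_hh]; ring),
    sum_band_shift hαβ hδ ψ (a' := β - α) (b' := β) (hh α β δ) (by rw [height_hh]; ring)
      (by rw [height_hh]; ring)]
  simp only [sub_eq_add_neg _ (hh α β δ)] at h1
  rw [sum_band_shift hαβ hδ φ (a' := -β) (b' := 0) (-hh α β δ)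
      (by rw [map_neg, height_hh]; ring) (by rw [map_neg, height_hh]; ring),
    sum_band_shift hαβ hδ ψ (a' := -α) (b' := β - α) (vv α β δ)
      (by rw [height_vv]; ring) (by rw [height_vv]; ring)] at h1
  have h2 := sum_band_add hαβ hδ ψ (a := 0) (b := β - α) (c := β) (by omega) (by omega)
  have h3 := sum_band_add hαβ hδ ψ (a := -α) (b := 0) (c := β - α) (by omega) (by omega)
  linear_combination h1 + h2 - h3

/-- The flux of two functions on the vertices through the loop around the tube. -/
def discreteFlux (f g : G α β δ → ℂ) : ℂ :=
  ∑ p ∈ band α β δ (-β) 0, (conj (f p) * g (p + hh α β δ) - conj (f (p + hh α β δ)) * g p) +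
    ∑ p ∈ band α β δ (-α) 0, (conj (f p) * g (p - vv α β δ) - conj (f (p - vv α β δ)) * g p)

/-- The Wronskian current is divergence-free: at `p` its divergence is `(κ - conj κ) * conj (f p) *
g p`, and `κ` is real. -/
theorem discreteFlux_shift (hαβ : Nat.Coprime α β) (hlt : α < β) (hδ : 1 ≤ δ) {κ : ℝ}
    {f g : G α β δ → ℂ} (hf : IsDiscrete (κ : ℂ) f) (hg : IsDiscrete (κ : ℂ) g) :
    discreteFlux (fun p => f (p + hh α β δ)) (fun p => g (p + hh α β δ)) = discreteFlux f g := by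
  have h := flow_shift hαβ hlt hδ
    (φ := fun p => conj (f p) * g (p + hh α β δ) - conj (f (p + hh α β δ)) * g p)
    (ψ := fun p => conj (f p) * g (p - vv α β δ) - conj (f (p - vv α β δ)) * g p) (fun p => by
      have h1 := congrArg conj (hf p)
      have h2 := hg p
      simp only [map_add, map_mul, Complex.conj_ofReal] at h1
      simp only [sub_add_cancel, add_sub_cancel_right]
      linear_combination conj (f p) * h2 - g p * h1)
  unfold discreteFlux
  simp only [add_sub_right_comm _ (hh α β δ) (vv α β δ)] at h ⊢
  exact h

/-- The flux involves only values on `𝒱₀`, which can be prescribed freely for `g`. Testing with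
point masses gives one relation for each vertex of `𝒱₀`, and these form a triangular system in the
height. -/
theorem discreteFlux_nondegenerate (hαβ : Nat.Coprime α β) (hα : 0 < α) (hlt : α < β)
    (hδ : 1 ≤ δ) {κ : ℂ} {f : G α β δ → ℂ}
    (h : ∀ g, IsDiscrete κ g → discreteFlux f g = 0) : ∀ p ∈ V0 α β δ, f p = 0 := by
  classical
  have hδfun : ∀ p₀ : G α β δ,
      ∑ p ∈ band α β δ (-β) 0, (conj (f p) * (if p + hh α β δ = p₀ then 1 else 0)
          - conj (f (p + hh α β δ)) * (if p = p₀ then 1 else 0)) +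
        ∑ p ∈ band α β δ (-α) 0, (conj (f p) * (if p - vv α β δ = p₀ then 1 else 0)
          - conj (f (p - vv α β δ)) * (if p = p₀ then 1 else 0)) = 0 := by
    intro p₀
    have h1 := h _ (isDiscrete_discreteExt hα hlt κ (fun p => if (p : G α β δ) = p₀ then 1 else 0))
    have h2 : ∀ p, -(β : ℤ) < height α β δ p → height α β δ p ≤ β →
        discreteExt hα hlt κ (fun p => if (p : G α β δ) = p₀ then 1 else 0) p
          = if p = p₀ then 1 else 0 := fun p hp hp' =>
      discreteExt_of_mem hα hlt κ _ ⟨p, (mem_V0 hα hlt p).2 ⟨hp, hp'⟩⟩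
    refine Eq.trans ?_ h1
    unfold discreteFlux
    congr 1
    · refine Finset.sum_congr rfl fun p hp => ?_
      rw [mem_band hαβ hδ] at hp
      rw [h2 p (by omega) (by omega), h2 (p + hh α β δ) (by rw [map_add, height_hh]; omega)
        (by rw [map_add, height_hh]; omega)]
    · refine Finset.sum_congr rfl fun p hp => ?_
      rw [mem_band hαβ hδ] at hp
      rw [h2 p (by omega) (by omega), h2 (p - vv α β δ) (by rw [map_sub, height_vv]; omega)
        (by rw [map_sub, height_vv]; omega)]
  simp only [← eq_sub_iff_add_eq, sub_eq_iff_eq_add, mul_ite, mul_one, mul_zero,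
    Finset.sum_sub_distrib, Finset.sum_ite_eq', mem_band hαβ hδ, map_add, map_sub, height_hh,
    height_vv] at hδfun
  have hlow : ∀ p, -(β : ℤ) < height α β δ p → height α β δ p ≤ 0 →
      f (p + hh α β δ) + (if -(α : ℤ) < height α β δ p then f (p - vv α β δ) else 0) = 0 := by
    intro p h1 h2
    have h3 := hδfun p
    rw [if_neg (show ¬(-(β : ℤ) < height α β δ p - β ∧ height α β δ p - β ≤ 0) by omega),
      if_neg (show ¬(-(α : ℤ) < height α β δ p + -α ∧ height α β δ p + -α ≤ 0) by omega),
      if_pos (show -(β : ℤ) < height α β δ p ∧ height α β δ p ≤ 0 by omega)] at h3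
    apply (starRingEnd ℂ).injective
    by_cases h4 : -(α : ℤ) < height α β δ p
    · rw [if_pos (show -(α : ℤ) < height α β δ p ∧ height α β δ p ≤ 0 by omega)] at h3
      rw [if_pos h4, map_add, map_zero]
      linear_combination -h3
    · rw [if_neg (show ¬(-(α : ℤ) < height α β δ p ∧ height α β δ p ≤ 0) by omega)] at h3
      rw [if_neg h4, add_zero, map_zero]
      linear_combination -h3
  have hhigh : ∀ p, 0 < height α β δ p → height α β δ p ≤ β →
      f (p - hh α β δ) + (if height α β δ p ≤ α then f (p + vv α β δ) else 0) = 0 := by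
    intro p h1 h2
    have h3 := hδfun p
    rw [if_pos (show -(β : ℤ) < height α β δ p - β ∧ height α β δ p - β ≤ 0 by omega),
      if_neg (show ¬(-(α : ℤ) < height α β δ p ∧ height α β δ p ≤ 0) by omega),
      if_neg (show ¬(-(β : ℤ) < height α β δ p ∧ height α β δ p ≤ 0) by omega)] at h3
    apply (starRingEnd ℂ).injective
    by_cases h4 : height α β δ p ≤ α
    · rw [if_pos (show -(α : ℤ) < height α β δ p + -α ∧ height α β δ p + -α ≤ 0 by omega)] at h3
      rw [if_pos h4, map_add, map_zero]
      linear_combination h3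
    · rw [if_neg (show ¬(-(α : ℤ) < height α β δ p + -α ∧ height α β δ p + -α ≤ 0) by omega)] at h3
      rw [if_neg h4, add_zero, map_zero]
      linear_combination h3
  -- The relation at `p + h` expresses `f p` through `f (p + h + v)`, which is higher by `β - α > 0`
  -- and still of height at most `0`, or makes `f p` vanish outright. The upper half below descends
  -- in the same way.
  have hlow0 : ∀ n : ℕ, ∀ p, -(β : ℤ) < height α β δ p → height α β δ p ≤ 0 →
      -height α β δ p = n → f p = 0 := by
    intro n
    induction n using Nat.strong_induction_on with
    | _ n ih =>
      intro p h1 h2 hn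
      have h3 := hhigh (p + hh α β δ) (by rw [map_add, height_hh]; omega)
        (by rw [map_add, height_hh]; omega)
      rw [add_sub_cancel_right, map_add, height_hh] at h3
      split_ifs at h3 with h4
      · have h5 : height α β δ (p + hh α β δ + vv α β δ) = height α β δ p + β - α := by
          rw [map_add, map_add, height_hh, height_vv]
          ring
        rw [ih (-height α β δ (p + hh α β δ + vv α β δ)).toNat (by omega)
          (p + hh α β δ + vv α β δ) (by omega) (by omega) (by omega)] at h3
        simpa using h3
      · simpa using h3
  have hhigh0 : ∀ n : ℕ, ∀ p, 0 < height α β δ p → height α β δ p ≤ β →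
      height α β δ p = n → f p = 0 := by
    intro n
    induction n using Nat.strong_induction_on with
    | _ n ih =>
      intro p h1 h2 hn
      have h3 := hlow (p - hh α β δ) (by rw [map_sub, height_hh]; omega)
        (by rw [map_sub, height_hh]; omega)
      rw [sub_add_cancel, map_sub, height_hh] at h3
      split_ifs at h3 with h4
      · have h5 : height α β δ (p - hh α β δ - vv α β δ) = height α β δ p - β + α := by
          rw [map_sub, map_sub, height_hh, height_vv]
          ring
        rw [ih (height α β δ (p - hh α β δ - vv α β δ)).toNat (by omega)
          (p - hh α β δ - vv α β δ) (by omega) (by omega) (by omega)] at h3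
        simpa using h3
      · simpa using h3
  intro p hp
  rw [mem_V0 hα hlt] at hp
  by_cases h0 : height α β δ p ≤ 0
  · exact hlow0 (-height α β δ p).toNat p hp.1 h0 (by omega)
  · exact hhigh0 (height α β δ p).toNat p (by omega) hp.2 (by omega)

end Group

/-! ### Operators preserving an indefinite Hermitian form -/

section FluxForm

variable {X : Type*} [AddCommGroup X] [Module ℂ X]

/-- One eigenvector for each eigenvalue gives a basis, by independence and counting. In it `T`
scales each coordinate by its own eigenvalue, so an eigenvector for `z` has only its `z`-coordinate.
-/
theorem eigenbasis_of_ncard_eq_finrank [FiniteDimensional ℂ X] {T : Module.End ℂ X}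
    (hT : {z : ℂ | T.HasEigenvalue z}.ncard = Module.finrank ℂ X) :
    (∀ (z : ℂ) (u v : X), u ≠ 0 → T u = z • u → T v = z • v → ∃ c : ℂ, v = c • u) ∧
      ∀ p : X →ₗ[ℂ] ℂ, (∀ (z : ℂ) v, T v = z • v → p v = 0) → p = 0 := by
  have hfin : {z : ℂ | T.HasEigenvalue z}.Finite := T.finite_hasEigenvalue
  have := hfin.fintype
  have hx : ∀ z : {z : ℂ | T.HasEigenvalue z}, ∃ x, T.HasEigenvector z x :=
    fun z => z.2.exists_hasEigenvector
  choose x hx using hx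
  have hli := T.eigenvectors_linearIndependent _ x hx
  have hspan := hli.span_eq_top_of_card_eq_finrank' (by
    rw [← hT, ← Nat.card_eq_fintype_card, Nat.card_coe_set_eq])
  let b := Module.Basis.mk hli hspan.ge
  have hb : ∀ y, T (b y) = (y : ℂ) • b y := fun y => by
    rw [Module.Basis.mk_apply]
    exact (hx y).apply_eq_smul
  have hcoord : ∀ y v, b.repr (T v) y = (y : ℂ) * b.repr v y := by
    intro y v
    have h : (b.coord y).comp T = (y : ℂ) • b.coord y := by
      refine b.ext fun i => ?_
      simp only [LinearMap.comp_apply, hb, map_smul, LinearMap.smul_apply, smul_eq_mul,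
        Module.Basis.coord_apply, Module.Basis.repr_self, Finsupp.single_apply]
      split_ifs with hi
      · rw [hi]
      · simp
    exact LinearMap.congr_fun h v
  constructor
  · intro z u v hu hTu hTv
    have hz : T.HasEigenvalue z :=
      Module.End.hasEigenvalue_of_hasEigenvector (x := u) ⟨by simpa using hTu, hu⟩
    have key : ∀ v, T v = z • v → v = b.repr v ⟨z, hz⟩ • b ⟨z, hz⟩ := by
      intro v hv
      refine b.ext_elem fun y => ?_
      rw [map_smul, Module.Basis.repr_self, Finsupp.smul_apply, Finsupp.single_apply]
      split_ifs with hy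
      · simp [hy]
      · have h1 := hcoord y v
        rw [hv, map_smul, Finsupp.smul_apply, smul_eq_mul] at h1
        have h2 : z - y ≠ 0 := fun h => hy (Subtype.ext (sub_eq_zero.1 h))
        have h3 : (z - y) * b.repr v y = 0 := by linear_combination h1
        simpa [h2] using h3
    have hu' := key u hTu
    have hne : b.repr u ⟨z, hz⟩ ≠ 0 := fun h => hu (by rw [hu', h, zero_smul])
    refine ⟨b.repr v ⟨z, hz⟩ / b.repr u ⟨z, hz⟩, ?_⟩
    nth_rewrite 2 [hu']
    rw [smul_smul, div_mul_cancel₀ _ hne]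
    exact key v hTv
  · intro p hp
    refine b.ext fun i => ?_
    rw [LinearMap.zero_apply]
    exact hp i _ (hb i)

/-- `F` is a nondegenerate Hermitian form that is invariant under `T`, and `C` is an antilinear map
commuting with `T` which changes the sign of `F`. -/
structure IsFluxForm (T : Module.End ℂ X) (F : X →ₗ⋆[ℂ] X →ₗ[ℂ] ℂ)
    (C : X →ₛₗ[starRingEnd ℂ] X) : Prop where
  symm : ∀ u v, F v u = conj (F u v)
  nondegenerate : ∀ u, (∀ v, F u v = 0) → u = 0
  invariant : ∀ u v, F (T u) (T v) = F u v
  conj_comm : ∀ u, T (C u) = C (T u)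
  conj_flux : ∀ u v, F (C u) (C v) = -conj (F u v)

/-- `z` is an eigenvalue on the unit circle with an eigenvector of negative flux. -/
def IsNegative (T : Module.End ℂ X) (F : X →ₗ⋆[ℂ] X →ₗ[ℂ] ℂ) (z : ℂ) : Prop :=
  ‖z‖ = 1 ∧ ∃ u, T u = z • u ∧ (F u u).re < 0

/-- `z` is an eigenvalue on the unit circle with an eigenvector of positive flux. -/
def IsPositive (T : Module.End ℂ X) (F : X →ₗ⋆[ℂ] X →ₗ[ℂ] ℂ) (z : ℂ) : Prop :=
  ‖z‖ = 1 ∧ ∃ u, T u = z • u ∧ 0 < (F u u).re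

/-- The other multiplier in the pair of multipliers containing `z`. -/
def partner (z : ℂ) : ℂ := if ‖z‖ = 1 then conj z else (conj z)⁻¹

theorem norm_partner {z : ℂ} : ‖partner z‖ = ‖z‖⁻¹ := by
  unfold partner
  split_ifs with h
  · rw [RCLike.norm_conj, h, inv_one]
  · rw [norm_inv, RCLike.norm_conj]

theorem partner_partner (z : ℂ) : partner (partner z) = z := by
  have h : ‖partner z‖ = 1 ↔ ‖z‖ = 1 := by rw [norm_partner, inv_eq_one]
  by_cases h1 : ‖z‖ = 1
  · rw [partner, if_pos (h.2 h1), partner, if_pos h1, Complex.conj_conj]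
  · rw [partner, if_neg (mt h.1 h1), partner, if_neg h1]
    simp

theorem conj_inv_of_norm_eq_one {z : ℂ} (h : ‖z‖ = 1) : (conj z)⁻¹ = z := by
  rw [← map_inv₀, Complex.inv_eq_conj h, Complex.conj_conj]

theorem ne_zero_of_flux_ne_zero {F : X →ₗ⋆[ℂ] X →ₗ[ℂ] ℂ} {u v : X} (h : F u v ≠ 0) :
    u ≠ 0 ∧ v ≠ 0 :=
  ⟨fun hu => h (by rw [hu, map_zero, LinearMap.zero_apply]), fun hv => h (by rw [hv, map_zero])⟩

variable {T : Module.End ℂ X} {F : X →ₗ⋆[ℂ] X →ₗ[ℂ] ℂ} {C : X →ₛₗ[starRingEnd ℂ] X}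

/-- Invariance reads `F u v = F (T u) (T v) = conj z * y * F u v`. -/
theorem IsFluxForm.orthogonal (hF : IsFluxForm T F C) {z y : ℂ} {u v : X} (hu : T u = z • u)
    (hv : T v = y • v) (h : conj z * y ≠ 1) : F u v = 0 := by
  have h1 := hF.invariant u v
  rw [hu, hv, map_smul, LinearMap.map_smulₛₗ, LinearMap.smul_apply, smul_eq_mul,
    smul_eq_mul] at h1
  have h2 : (conj z * y - 1) * F u v = 0 := by linear_combination h1
  simpa [sub_ne_zero.2 h] using h2

theorem IsFluxForm.im_eq_zero (hF : IsFluxForm T F C) (u : X) : (F u u).im = 0 :=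
  Complex.conj_eq_iff_im.1 (hF.symm u u).symm

/-- By nondegeneracy `F u` is not zero, hence not zero on some eigenvector, and orthogonality leaves
only one possible eigenvalue for it. -/
theorem IsFluxForm.exists_partner [FiniteDimensional ℂ X] (hF : IsFluxForm T F C)
    (hT : {z : ℂ | T.HasEigenvalue z}.ncard = Module.finrank ℂ X) {z : ℂ} {u : X} (hu0 : u ≠ 0)
    (hu : T u = z • u) : z ≠ 0 ∧ ∃ v, T v = (conj z)⁻¹ • v ∧ F u v ≠ 0 := by
  have h : ∃ (y : ℂ) (v : X), T v = y • v ∧ F u v ≠ 0 := by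
    by_contra! h
    exact hu0 (hF.nondegenerate u fun v => by
      rw [(eigenbasis_of_ncard_eq_finrank hT).2 (F u) h, LinearMap.zero_apply])
  obtain ⟨y, v, hv, huv⟩ := h
  have h1 : conj z * y = 1 := by
    by_contra h1
    exact huv (hF.orthogonal hu hv h1)
  refine ⟨fun h0 => by simp [h0] at h1, v, ?_, huv⟩
  rwa [← eq_inv_of_mul_eq_one_right h1]

/-- On the unit circle `(conj z)⁻¹ = z`, so the vector that pairs with `u` is a multiple of `u`. -/
theorem IsFluxForm.isNegative_or_isPositive [FiniteDimensional ℂ X] (hF : IsFluxForm T F C)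
    (hT : {z : ℂ | T.HasEigenvalue z}.ncard = Module.finrank ℂ X) {z : ℂ}
    (hz : T.HasEigenvalue z) (hz1 : ‖z‖ = 1) : IsNegative T F z ∨ IsPositive T F z := by
  obtain ⟨u, hu⟩ := hz.exists_hasEigenvector
  obtain ⟨-, v, hv, huv⟩ := hF.exists_partner hT hu.2 hu.apply_eq_smul
  rw [conj_inv_of_norm_eq_one hz1] at hv
  obtain ⟨c, rfl⟩ := (eigenbasis_of_ncard_eq_finrank hT).1 z u v hu.2 hu.apply_eq_smul hv
  have hne : (F u u).re ≠ 0 := fun h => huv (by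
    rw [map_smul, Complex.ext (z := F u u) (w := 0) h (hF.im_eq_zero u), smul_zero])
  rcases lt_or_gt_of_ne hne with h | h
  · exact Or.inl ⟨hz1, u, hu.apply_eq_smul, h⟩
  · exact Or.inr ⟨hz1, u, hu.apply_eq_smul, h⟩

theorem flux_smul_smul_re (c : ℂ) (u : X) :
    (F (c • u) (c • u)).re = Complex.normSq c * (F u u).re := by
  rw [map_smul, LinearMap.map_smulₛₗ, LinearMap.smul_apply, smul_eq_mul, smul_eq_mul,
    ← mul_assoc, mul_comm c, ← Complex.normSq_eq_conj_mul_self, Complex.re_ofReal_mul]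

theorem not_isNegative_and_isPositive [FiniteDimensional ℂ X]
    (hT : {z : ℂ | T.HasEigenvalue z}.ncard = Module.finrank ℂ X) {z : ℂ}
    (hn : IsNegative T F z) (hp : IsPositive T F z) : False := by
  obtain ⟨-, u, hu, hun⟩ := hn
  obtain ⟨-, v, hv, hvp⟩ := hp
  have hu0 : u ≠ 0 := (ne_zero_of_flux_ne_zero (F := F) (u := u) (v := u) fun h => by
    simp [h] at hun).1
  obtain ⟨c, rfl⟩ := (eigenbasis_of_ncard_eq_finrank hT).1 z u v hu0 hu hv
  rw [flux_smul_smul_re] at hvp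
  nlinarith [Complex.normSq_nonneg c]

theorem IsFluxForm.conj_eigen (hF : IsFluxForm T F C) {z : ℂ} {u : X} (hu : T u = z • u) :
    T (C u) = conj z • C u ∧ (F (C u) (C u)).re = -(F u u).re := by
  rw [hF.conj_comm, hu, LinearMap.map_smulₛₗ, hF.conj_flux]
  simp

theorem IsNegative.conj (hF : IsFluxForm T F C) {z : ℂ} (h : IsNegative T F z) :
    IsPositive T F (conj z) := by
  obtain ⟨h1, u, hu, hn⟩ := h
  refine ⟨by rwa [RCLike.norm_conj], C u, (hF.conj_eigen hu).1, ?_⟩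
  rw [(hF.conj_eigen hu).2]
  linarith

theorem IsPositive.conj (hF : IsFluxForm T F C) {z : ℂ} (h : IsPositive T F z) :
    IsNegative T F (conj z) := by
  obtain ⟨h1, u, hu, hn⟩ := h
  refine ⟨by rwa [RCLike.norm_conj], C u, (hF.conj_eigen hu).1, ?_⟩
  rw [(hF.conj_eigen hu).2]
  linarith

theorem hasEigenvalue_of_apply_eq {z : ℂ} {u : X} (hu0 : u ≠ 0) (hu : T u = z • u) :
    T.HasEigenvalue z :=
  Module.End.hasEigenvalue_of_hasEigenvector (x := u) ⟨by simpa using hu, hu0⟩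

theorem IsNegative.hasEigenvalue {z : ℂ} (h : IsNegative T F z) : T.HasEigenvalue z := by
  obtain ⟨-, u, hu, hn⟩ := h
  exact hasEigenvalue_of_apply_eq
    (ne_zero_of_flux_ne_zero (F := F) (u := u) (v := u) fun h => by simp [h] at hn).1 hu

theorem IsPositive.hasEigenvalue {z : ℂ} (h : IsPositive T F z) : T.HasEigenvalue z := by
  obtain ⟨-, u, hu, hn⟩ := h
  exact hasEigenvalue_of_apply_eq
    (ne_zero_of_flux_ne_zero (F := F) (u := u) (v := u) fun h => by simp [h] at hn).1 hu

/-- Eigenvectors for the pair of a negative eigenvalue and its conjugate, normalized by flux. -/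
theorem IsNegative.exists_pair [FiniteDimensional ℂ X] (hF : IsFluxForm T F C)
    (hT : {z : ℂ | T.HasEigenvalue z}.ncard = Module.finrank ℂ X) {z : ℂ}
    (hz : IsNegative T F z) :
    ∃ u : Fin 2 → X, T (u 0) = z • u 0 ∧ T (u 1) = conj z • u 1 ∧
      ∀ k l, F (u k) (u l) = if k = l then (-1 : ℂ) ^ ((l : ℕ) + 1) else 0 := by
  obtain ⟨hz1, u, hu, hn⟩ := id hz
  obtain ⟨r, hr⟩ : ∃ r : ℝ, F u u = -((r ^ 2 : ℝ) : ℂ) ∧ r ≠ 0 := by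
    refine ⟨Real.sqrt (-(F u u).re), ?_, (Real.sqrt_pos.2 (by linarith)).ne'⟩
    rw [Real.sq_sqrt (by linarith)]
    apply Complex.ext <;> simp [hF.im_eq_zero]
  obtain ⟨hr, hr0⟩ := hr
  have hr0' : (r : ℂ) ≠ 0 := by exact_mod_cast hr0
  set u0 : X := ((r⁻¹ : ℝ) : ℂ) • u with hu0
  have h0 : T u0 = z • u0 := by rw [hu0, map_smul, hu, smul_comm]
  have h00 : F u0 u0 = -1 := by
    rw [hu0, map_smul, LinearMap.map_smulₛₗ, LinearMap.smul_apply, Complex.conj_ofReal, hr]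
    simp only [smul_eq_mul]
    push_cast
    field_simp
  have h1 := (hF.conj_eigen h0).1
  -- Otherwise `z` would be real, and `C` would produce an eigenvector of opposite flux sign on the
  -- same eigenline.
  have h01 : F u0 (C u0) = 0 := by
    refine hF.orthogonal h0 h1 fun h => ?_
    have h2 : z = conj z := by
      rw [eq_inv_of_mul_eq_one_right h, conj_inv_of_norm_eq_one hz1]
    have h3 := hz.conj hF
    rw [← h2] at h3
    exact not_isNegative_and_isPositive hT hz h3
  refine ⟨![u0, C u0], h0, h1, ?_⟩
  rw [Fin.forall_fin_two, Fin.forall_fin_two, Fin.forall_fin_two]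
  simp only [Matrix.cons_val_zero, Matrix.cons_val_one, hF.conj_flux, hF.symm u0 (C u0), h00, h01]
  simp

/-- Eigenvectors for the pair of an eigenvalue in the unit disk and its reflection, normalized by
flux. -/
theorem IsFluxForm.exists_pair_of_norm_lt_one [FiniteDimensional ℂ X] (hF : IsFluxForm T F C)
    (hT : {z : ℂ | T.HasEigenvalue z}.ncard = Module.finrank ℂ X) {z : ℂ}
    (hz : T.HasEigenvalue z) (hz1 : ‖z‖ < 1) :
    ∃ u : Fin 2 → X, T (u 0) = z • u 0 ∧ T (u 1) = (conj z)⁻¹ • u 1 ∧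
      ∀ k l, F (u k) (u l) = if k = l then 0 else 1 := by
  obtain ⟨u, hu⟩ := hz.exists_hasEigenvector
  have hu' := hu.apply_eq_smul
  obtain ⟨hz0, v, hv, huv⟩ := hF.exists_partner hT hu.2 hu'
  have h00 : F u u = 0 := hF.orthogonal hu' hu' fun h => by
    have := congrArg norm h
    rw [norm_mul, RCLike.norm_conj, norm_one] at this
    nlinarith [norm_nonneg z]
  have h11 : F v v = 0 := hF.orthogonal hv hv fun h => by
    have := congrArg norm h
    rw [norm_mul, RCLike.norm_conj, norm_one, norm_inv, RCLike.norm_conj] at this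
    have h2 : 0 < ‖z‖ := norm_pos_iff.2 hz0
    field_simp at this
    nlinarith
  have h01 : F u ((F u v)⁻¹ • v) = 1 := by
    rw [map_smul, smul_eq_mul, inv_mul_cancel₀ huv]
  refine ⟨![u, (F u v)⁻¹ • v], hu', ?_, ?_⟩
  · change T ((F u v)⁻¹ • v) = (conj z)⁻¹ • (F u v)⁻¹ • v
    rw [map_smul, hv, smul_comm]
  · rw [Fin.forall_fin_two, Fin.forall_fin_two, Fin.forall_fin_two]
    simp only [Matrix.cons_val_zero, Matrix.cons_val_one, hF.symm u ((F u v)⁻¹ • v), h00, h01]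
    simp [h11]

theorem IsFluxForm.hasEigenvalue_partner [FiniteDimensional ℂ X] (hF : IsFluxForm T F C)
    (hT : {z : ℂ | T.HasEigenvalue z}.ncard = Module.finrank ℂ X) {z : ℂ}
    (hz : T.HasEigenvalue z) : T.HasEigenvalue (partner z) := by
  obtain ⟨u, hu⟩ := hz.exists_hasEigenvector
  have hu' := hu.apply_eq_smul
  unfold partner
  split_ifs with h
  · rcases hF.isNegative_or_isPositive hT hz h with h | h
    · exact (h.conj hF).hasEigenvalue
    · exact (h.conj hF).hasEigenvalue
  · obtain ⟨-, v, hv, huv⟩ := hF.exists_partner hT hu.2 hu'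
    exact hasEigenvalue_of_apply_eq (ne_zero_of_flux_ne_zero huv).2 hv

/-- Being of negative flux on the circle or inside the disk selects exactly one eigenvalue from each
pair, so `partner` has no fixed point in the spectrum. -/
theorem IsFluxForm.partner_mem_iff [FiniteDimensional ℂ X] (hF : IsFluxForm T F C)
    (hT : {z : ℂ | T.HasEigenvalue z}.ncard = Module.finrank ℂ X) {z : ℂ}
    (hz : T.HasEigenvalue z) :
    (IsNegative T F (partner z) ∨ ‖partner z‖ < 1) ↔ ¬(IsNegative T F z ∨ ‖z‖ < 1) := by
  obtain ⟨u, hu⟩ := hz.exists_hasEigenvector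
  have hz0 : 0 < ‖z‖ := norm_pos_iff.2 (hF.exists_partner hT hu.2 hu.apply_eq_smul).1
  rw [norm_partner]
  rcases lt_trichotomy ‖z‖ 1 with h | h | h
  · have h1 : 1 < ‖z‖⁻¹ := (one_lt_inv₀ hz0).2 h
    have h2 : ¬IsNegative T F (partner z) := fun h' => by
      have := h'.1
      rw [norm_partner] at this
      linarith
    simp [h, h1.le, h2]
  · have h2 : partner z = conj z := if_pos h
    rw [h2, h]
    simp only [inv_one, lt_irrefl, or_false]
    rcases hF.isNegative_or_isPositive hT hz h with hs | hs
    · exact ⟨fun hn _ => not_isNegative_and_isPositive hT hn (hs.conj hF), fun hn => (hn hs).elim⟩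
    · exact ⟨fun _ hn => not_isNegative_and_isPositive hT hn hs, fun _ => hs.conj hF⟩
  · have h1 : ‖z‖⁻¹ < 1 := inv_lt_one_of_one_lt₀ h
    have h2 : ¬IsNegative T F z := fun h' => by
      have := h'.1
      linarith
    simp [h1, h2, h.le]

/-- An enumeration of the pairs of eigenvalues. -/
theorem IsFluxForm.exists_enumeration [FiniteDimensional ℂ X] (hF : IsFluxForm T F C) {d : ℕ}
    (hT : {z : ℂ | T.HasEigenvalue z}.ncard = Module.finrank ℂ X)
    (hd : Module.finrank ℂ X = 2 * d) :
    ∃ N ≤ d, ∃ f : Fin d → ℂ, Function.Injective f ∧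
      (∀ j : Fin d, (j : ℕ) < N → IsNegative T F (f j)) ∧
      (∀ j : Fin d, N ≤ (j : ℕ) → T.HasEigenvalue (f j) ∧ ‖f j‖ < 1) ∧
      ∀ z, T.HasEigenvalue z → ∃ j, z = f j ∨ z = partner (f j) := by
  have hfin : {z : ℂ | T.HasEigenvalue z}.Finite := T.finite_hasEigenvalue
  set A : Set ℂ := {z | IsNegative T F z} with hA
  set B : Set ℂ := {z | T.HasEigenvalue z ∧ ‖z‖ < 1} with hB
  have hAfin : A.Finite := hfin.subset fun z hz => IsNegative.hasEigenvalue hz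
  have hBfin : B.Finite := hfin.subset fun z hz => hz.1
  have hAB : Disjoint A B := Set.disjoint_left.2 fun z hz hz' => by
    have h1 : ‖z‖ = 1 := hz.1
    have h2 : ‖z‖ < 1 := hz'.2
    linarith
  have hmem : ∀ z, z ∈ A ∪ B ↔ T.HasEigenvalue z ∧ (IsNegative T F z ∨ ‖z‖ < 1) := by
    intro z
    constructor
    · rintro (h | h)
      · exact ⟨IsNegative.hasEigenvalue h, Or.inl h⟩
      · exact ⟨h.1, Or.inr h.2⟩
    · rintro ⟨h, h' | h'⟩
      · exact Or.inl h'
      · exact Or.inr ⟨h, h'⟩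
  have hsplit : {z : ℂ | T.HasEigenvalue z} = (A ∪ B) ∪ partner '' (A ∪ B) := by
    ext z
    constructor
    · intro hz
      by_cases h : IsNegative T F z ∨ ‖z‖ < 1
      · exact Or.inl ((hmem z).2 ⟨hz, h⟩)
      · refine Or.inr ⟨partner z, (hmem _).2 ⟨hF.hasEigenvalue_partner hT hz, ?_⟩,
          partner_partner z⟩
        exact (hF.partner_mem_iff hT hz).2 h
    · rintro (h | ⟨y, h, rfl⟩)
      · exact ((hmem z).1 h).1
      · exact hF.hasEigenvalue_partner hT ((hmem y).1 h).1
  have hdisj : Disjoint (A ∪ B) (partner '' (A ∪ B)) := by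
    rw [Set.disjoint_left]
    rintro _ hz ⟨y, hy, rfl⟩
    rw [hmem] at hy hz
    exact (hF.partner_mem_iff hT hy.1).1 hz.2 hy.2
  -- `partner` is an involution, so the spectrum of `2 * d` points is two disjoint copies of `A ∪
  -- B`.
  have hcard : A.ncard + B.ncard = d := by
    have h1 := hT
    rw [hsplit, Set.ncard_union_eq hdisj (hAfin.union hBfin) ((hAfin.union hBfin).image _),
      Set.ncard_image_of_injective _ (Function.LeftInverse.injective partner_partner),
      Set.ncard_union_eq hAB hAfin hBfin] at h1
    omega
  have := hAfin.to_subtype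
  have := hBfin.to_subtype
  have eA : A ≃ Fin A.ncard := Finite.equivFinOfCardEq (Nat.card_coe_set_eq A)
  have eB : B ≃ Fin B.ncard := Finite.equivFinOfCardEq (Nat.card_coe_set_eq B)
  generalize A.ncard = N at hcard eA
  generalize B.ncard = M at hcard eB
  subst hcard
  refine ⟨N, Nat.le_add_right _ _,
    Fin.append (fun i => (eA.symm i : ℂ)) (fun i => (eB.symm i : ℂ)), ?_, ?_, ?_, ?_⟩
  · rw [Fin.append_injective_iff]
    refine ⟨Subtype.val_injective.comp eA.symm.injective,
      Subtype.val_injective.comp eB.symm.injective, fun i j h => ?_⟩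
    exact Set.disjoint_left.1 hAB (eA.symm i).2 (h ▸ (eB.symm j).2)
  · intro j
    refine Fin.addCases (fun i _ => ?_) (fun i h => ?_) j
    · rw [Fin.append_left]
      exact (eA.symm i).2
    · simp at h
  · intro j
    refine Fin.addCases (fun i h => ?_) (fun i _ => ?_) j
    · have := i.2
      simp at h
      omega
    · rw [Fin.append_right]
      exact (eB.symm i).2
  · have key : ∀ z ∈ A ∪ B, ∃ j : Fin (N + M),
        z = Fin.append (fun i => (eA.symm i : ℂ)) (fun i => (eB.symm i : ℂ)) j := by
      rintro z (hz | hz)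
      · exact ⟨Fin.castAdd M (eA ⟨z, hz⟩), by simp⟩
      · exact ⟨Fin.natAdd N (eB ⟨z, hz⟩), by simp⟩
    intro z hz
    have hz' : z ∈ {z : ℂ | T.HasEigenvalue z} := hz
    rw [hsplit] at hz'
    rcases hz' with h | ⟨y, h, rfl⟩
    · obtain ⟨j, hj⟩ := key z h
      exact ⟨j, Or.inl hj⟩
    · obtain ⟨j, hj⟩ := key y h
      exact ⟨j, Or.inr (by rw [hj])⟩

/-- The canonical form of an operator with simple eigenvalues that preserves a nondegenerate
Hermitian form whose sign is reversed by a commuting antilinear map. -/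
theorem IsFluxForm.exists_canonical_basis [FiniteDimensional ℂ X] (hF : IsFluxForm T F C) {d : ℕ}
    (hT : {z : ℂ | T.HasEigenvalue z}.ncard = Module.finrank ℂ X)
    (hd : Module.finrank ℂ X = 2 * d) :
    ∃ N ≤ d, ∃ (w : Fin d → Fin 2 → ℂ) (u : Fin d → Fin 2 → X),
      (∀ j : Fin d, (j : ℕ) < N → ‖w j 0‖ = 1 ∧ w j 1 = conj (w j 0)) ∧
      (∀ j : Fin d, N ≤ (j : ℕ) → w j 0 ≠ 0 ∧ ‖w j 0‖ < 1 ∧ w j 1 = (conj (w j 0))⁻¹) ∧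
      (∀ j k j' k', w j k = w j' k' → j = j' ∧ k = k') ∧
      {z : ℂ | T.HasEigenvalue z} = {z : ℂ | ∃ j k, w j k = z} ∧
      (∀ j k, T.HasEigenvector (w j k) (u j k)) ∧
      Submodule.span ℂ (Set.range fun p : Fin d × Fin 2 => u p.1 p.2) = ⊤ ∧
      (∀ (j : Fin d) (k l : Fin 2), (j : ℕ) < N →
        F (u j k) (u j l) = if k = l then (-1 : ℂ) ^ ((l : ℕ) + 1) else 0) ∧
      (∀ (j : Fin d) (k l : Fin 2), N ≤ (j : ℕ) →
        F (u j k) (u j l) = if k = l then 0 else 1) ∧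
      (∀ j j' k l, j ≠ j' → F (u j k) (u j' l) = 0) := by
  obtain ⟨N, hN, f, hf, hneg, hin, hall⟩ := hF.exists_enumeration hT hd
  have hev : ∀ j, T.HasEigenvalue (f j) := fun j => by
    rcases lt_or_ge (j : ℕ) N with h | h
    · exact (hneg j h).hasEigenvalue
    · exact (hin j h).1
  have hhalf : ∀ j, IsNegative T F (f j) ∨ ‖f j‖ < 1 := fun j => by
    rcases lt_or_ge (j : ℕ) N with h | h
    · exact Or.inl (hneg j h)
    · exact Or.inr (hin j h).2
  have hne : ∀ j, f j ≠ 0 := fun j => by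
    obtain ⟨u, hu⟩ := (hev j).exists_hasEigenvector
    exact (hF.exists_partner hT hu.2 hu.apply_eq_smul).1
  have hp1 : ∀ j : Fin d, (j : ℕ) < N → partner (f j) = conj (f j) := fun j hj =>
    if_pos (hneg j hj).1
  have hp2 : ∀ j : Fin d, N ≤ (j : ℕ) → partner (f j) = (conj (f j))⁻¹ := fun j hj =>
    if_neg (hin j hj).2.ne
  have hu : ∀ j : Fin d, ∃ u : Fin 2 → X, T (u 0) = f j • u 0 ∧ T (u 1) = partner (f j) • u 1 ∧
      ((j : ℕ) < N → ∀ k l, F (u k) (u l) = if k = l then (-1 : ℂ) ^ ((l : ℕ) + 1) else 0) ∧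
      (N ≤ (j : ℕ) → ∀ k l, F (u k) (u l) = if k = l then 0 else 1) := by
    intro j
    rcases lt_or_ge (j : ℕ) N with h | h
    · obtain ⟨u, h1, h2, h3⟩ := (hneg j h).exists_pair hF hT
      exact ⟨u, h1, by rwa [hp1 j h], fun _ => h3, fun h' => absurd h (by omega)⟩
    · obtain ⟨u, h1, h2, h3⟩ := hF.exists_pair_of_norm_lt_one hT (hin j h).1 (hin j h).2
      exact ⟨u, h1, by rwa [hp2 j h], fun h' => absurd h (by omega), fun _ => h3⟩
  choose u hu0 hu1 huN huM using hu
  let w : Fin d → Fin 2 → ℂ := fun j => ![f j, partner (f j)]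
  have hw0 : ∀ j, w j 0 = f j := fun j => rfl
  have hw1 : ∀ j, w j 1 = partner (f j) := fun j => rfl
  have hinj : ∀ j k j' k', w j k = w j' k' → j = j' ∧ k = k' := by
    have hcross : ∀ j j', f j ≠ partner (f j') := fun j j' h =>
      (hF.partner_mem_iff hT (hev j')).1 (h ▸ hhalf j) (hhalf j')
    intro j k j' k' h
    fin_cases k <;> fin_cases k'
    · exact ⟨hf h, rfl⟩
    · exact absurd h (hcross j j')
    · exact absurd h.symm (hcross j' j)
    · exact ⟨hf ((Function.LeftInverse.injective partner_partner) h), rfl⟩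
  have hTu : ∀ j k, T (u j k) = w j k • u j k := by
    intro j k
    fin_cases k
    · exact hu0 j
    · exact hu1 j
  have hune : ∀ j k, u j k ≠ 0 := by
    intro j k
    rcases lt_or_ge (j : ℕ) N with h | h
    · refine (ne_zero_of_flux_ne_zero (F := F) (u := u j k) (v := u j k) ?_).1
      rw [huN j h, if_pos rfl]
      exact pow_ne_zero _ (by norm_num)
    -- Both vectors are isotropic here; only the pairing with the other member of the pair is
    -- nonzero.
    · refine (ne_zero_of_flux_ne_zero (F := F) (u := u j k) (v := u j (1 - k)) ?_).1
      rw [huM j h, if_neg (by fin_cases k <;> decide)]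
      exact one_ne_zero
  have hvec : ∀ j k, T.HasEigenvector (w j k) (u j k) := fun j k =>
    ⟨by simpa using hTu j k, hune j k⟩
  refine ⟨N, hN, w, u, fun j hj => ⟨(hneg j hj).1, hp1 j hj⟩,
    fun j hj => ⟨hne j, (hin j hj).2, hp2 j hj⟩, hinj, ?_, hvec, ?_, fun j k l hj => huN j hj k l,
    fun j k l hj => huM j hj k l, ?_⟩
  · ext z
    constructor
    · intro hz
      obtain ⟨j, h | h⟩ := hall z hz
      · exact ⟨j, 0, h.symm⟩
      · exact ⟨j, 1, h.symm⟩
    · rintro ⟨j, k, rfl⟩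
      exact Module.End.hasEigenvalue_of_hasEigenvector (hvec j k)
  · refine LinearIndependent.span_eq_top_of_card_eq_finrank'
      (T.eigenvectors_linearIndependent' (fun p : Fin d × Fin 2 => w p.1 p.2) ?_ _
        fun p => hvec p.1 p.2) ?_
    · rintro ⟨j, k⟩ ⟨j', k'⟩ h
      obtain ⟨rfl, rfl⟩ := hinj _ _ _ _ h
      rfl
    · rw [hd]
      simp [mul_comm]
  · intro j j' k l hjj'
    refine hF.orthogonal (hTu j k) (hTu j' l) fun h => hjj' ?_
    have h1 : w j' l = (conj (w j k))⁻¹ := eq_inv_of_mul_eq_one_right h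
    -- The only eigenvalue that can pair with `w j k` belongs to pair `j` itself: the same member on
    -- the circle, the other one off it.
    obtain ⟨k', hk'⟩ : ∃ k', (conj (w j k))⁻¹ = w j k' := by
      rcases lt_or_ge (j : ℕ) N with hj | hj
      · refine ⟨k, conj_inv_of_norm_eq_one ?_⟩
        fin_cases k
        · exact (hneg j hj).1
        · change ‖partner (f j)‖ = 1
          rw [norm_partner, (hneg j hj).1, inv_one]
      · fin_cases k
        · exact ⟨1, (hp2 j hj).symm⟩
        · refine ⟨0, ?_⟩
          change (conj (partner (f j)))⁻¹ = f j
          rw [hp2 j hj]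
          simp
    exact (hinj _ _ _ _ (h1.trans hk')).1.symm

end FluxForm

/-! ### Functions in `V_lam` and their values at the vertices -/

section Tube

variable {α β δ : ℕ} {q : ℝ → ℝ} {lam : ℝ}

/-- The values of a function on the tube at the vertices. -/
def vals (u : Tube α β δ → ℂ) (p : G α β δ) : ℂ := u (Tube.vertex p)

theorem onEdge_zero (u : Tube α β δ → ℂ) (e : Edge α β δ) : onEdge u e 0 = vals u e.src := by
  simp [onEdge, vals]

theorem onEdge_one (u : Tube α β δ → ℂ) (e : Edge α β δ) : onEdge u e 1 = vals u e.tgt := by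
  simp [onEdge, vals]

theorem onEdge_of_mem_Ioo (u : Tube α β δ → ℂ) (e : Edge α β δ) (x : Set.Ioo (0 : ℝ) 1) :
    onEdge u e x = u (Tube.interior e x) := by
  rw [onEdge, dif_pos x.2]

theorem onEdge_comp_shift (u : Tube α β δ → ℂ) (g : G α β δ) (e : Edge α β δ) :
    onEdge (u ∘ shift g) e = onEdge u (e.1 + g, e.2) := by
  obtain ⟨p, d⟩ := e
  funext x
  have h : Edge.tgt (p, d) + g = Edge.tgt (p + g, d) := by
    cases d
    · simp only [Edge.tgt]
      abel
    · simp only [Edge.tgt]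
      abel
  simp only [onEdge, Function.comp_apply, shift, h]
  rfl

theorem comp_shift_mem_V (g : G α β δ) {u : Tube α β δ → ℂ} (hu : u ∈ V α β δ q lam) :
    u ∘ shift g ∈ V α β δ q lam := by
  refine ⟨fun e => ?_, fun p => ?_⟩
  · rw [onEdge_comp_shift]
    exact hu.1 _
  · have h := hu.2 (p + g)
    unfold Neumann at h ⊢
    simp only [onEdge_comp_shift]
    rwa [sub_add_eq_add_sub p (hh α β δ) g, add_right_comm p (vv α β δ) g]

theorem onEdge_conj (u : Tube α β δ → ℂ) (e : Edge α β δ) :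
    onEdge (fun x => conj (u x)) e = fun x => conj (onEdge u e x) := by
  funext x
  simp only [onEdge]
  split_ifs <;> rfl

theorem conj_mem_V (hq : GoodPot q lam) {u : Tube α β δ → ℂ} (hu : u ∈ V α β δ q lam) :
    (fun x => conj (u x)) ∈ V α β δ q lam := by
  refine ⟨fun e => ?_, fun p => ?_⟩
  · rw [onEdge_conj]
    exact ((hu.1 e).conj hq).1
  · have h := congrArg conj (hu.2 p)
    unfold Neumann at h ⊢
    simp only [onEdge_conj]
    rw [((hu.1 _).conj hq).2 0 (by simp), ((hu.1 _).conj hq).2 1 (by simp),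
      ((hu.1 _).conj hq).2 0 (by simp), ((hu.1 _).conj hq).2 1 (by simp)]
    simpa using h

/-- The real numbers `A`, `B` are the entries of the Dirichlet-to-Neumann matrix of an edge, and the
boundary value problem on an edge is uniquely solvable. -/
structure IsDirichletToNeumann (q : ℝ → ℝ) (lam A B : ℝ) : Prop where
  goodPot : GoodPot q lam
  ne_zero : B ≠ 0
  deriv_eq : ∀ y, SolvesODE q lam y →
    D y 0 = A * y 0 + B * y 1 ∧ D y 1 = -(B * y 0) - A * y 1
  exists_solution : ∀ a b : ℂ, ∃ y, SolvesODE q lam y ∧ y 0 = a ∧ y 1 = b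
  eq_zero : ∀ y, SolvesODE q lam y → y 0 = 0 → y 1 = 0 → ∀ x ∈ Set.Icc (0 : ℝ) 1, y x = 0

variable {A B : ℝ}

/-- Each of the four edges contributes `A` times the value at `p` plus `B` times the value at its
other end. -/
theorem neumann_iff (hAB : IsDirichletToNeumann q lam A B) {u : Tube α β δ → ℂ}
    (hu : ∀ e, SolvesODE q lam (onEdge u e)) (p : G α β δ) :
    Neumann u p ↔
      vals u (p + hh α β δ) + vals u (p - hh α β δ) + vals u (p + vv α β δ) +
        vals u (p - vv α β δ) = ((-(4 * A / B) : ℝ) : ℂ) * vals u p := by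
  have hB : (B : ℂ) ≠ 0 := by exact_mod_cast hAB.ne_zero
  unfold Neumann
  rw [(hAB.deriv_eq _ (hu _)).1, (hAB.deriv_eq _ (hu _)).1, (hAB.deriv_eq _ (hu _)).2,
    (hAB.deriv_eq _ (hu _)).2]
  simp only [onEdge_zero, onEdge_one, Edge.src, Edge.tgt, sub_add_cancel, add_sub_cancel_right]
  push_cast
  constructor
  · intro h
    field_simp
    linear_combination h
  · intro h
    field_simp at h
    linear_combination h

theorem isDiscrete_vals (hAB : IsDirichletToNeumann q lam A B) {u : Tube α β δ → ℂ}
    (hu : u ∈ V α β δ q lam) : IsDiscrete ((-(4 * A / B) : ℝ) : ℂ) (vals u) := fun p =>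
  (neumann_iff hAB hu.1 p).1 (hu.2 p)

theorem exists_mem_V_vals_eq (hAB : IsDirichletToNeumann q lam A B) {f : G α β δ → ℂ}
    (hf : IsDiscrete ((-(4 * A / B) : ℝ) : ℂ) f) : ∃ u ∈ V α β δ q lam, vals u = f := by
  choose Y hY hY0 hY1 using fun e : Edge α β δ => hAB.exists_solution (f e.src) (f e.tgt)
  let u : Tube α β δ → ℂ := fun x => match x with
    | Tube.vertex p => f p
    | Tube.interior e x => Y e x
  have hu : ∀ e, Set.EqOn (Y e) (onEdge u e) (Set.Icc 0 1) := by
    intro e x hx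
    rcases eq_or_lt_of_le hx.1 with rfl | h0
    · rw [onEdge_zero, hY0]
      rfl
    rcases eq_or_lt_of_le hx.2 with rfl | h1
    · rw [onEdge_one, hY1]
      rfl
    exact (onEdge_of_mem_Ioo u e ⟨x, h0, h1⟩).symm
  have hu' : ∀ e, SolvesODE q lam (onEdge u e) := fun e => (hY e).congr hAB.goodPot (hu e)
  exact ⟨u, ⟨hu', fun p => (neumann_iff hAB hu' p).2 (hf p)⟩, rfl⟩

theorem eq_zero_of_vals_eq_zero (hAB : IsDirichletToNeumann q lam A B) {u : Tube α β δ → ℂ}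
    (hu : u ∈ V α β δ q lam) (h : ∀ p, vals u p = 0) : u = 0 := by
  funext x
  cases x with
  | vertex p => exact h p
  | interior e x =>
    rw [← onEdge_of_mem_Ioo u]
    exact hAB.eq_zero _ (hu.1 e) (by rw [onEdge_zero, h]) (by rw [onEdge_one, h]) x
      (Set.Ioo_subset_Icc_self x.2)

/-- The terms with `A` cancel because `A` is real. -/
theorem edgeFlux_eq (hAB : IsDirichletToNeumann q lam A B) {u v : Tube α β δ → ℂ}
    (hu : u ∈ V α β δ q lam) (hv : v ∈ V α β δ q lam) (e : Edge α β δ) :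
    edgeFlux u v e = (2 * Complex.I)⁻¹ * B *
      (conj (vals u e.src) * vals v e.tgt - conj (vals u e.tgt) * vals v e.src) := by
  unfold edgeFlux
  rw [(hAB.deriv_eq _ (hu.1 e)).1, (hAB.deriv_eq _ (hv.1 e)).1]
  simp only [onEdge_zero, onEdge_one, map_add, map_mul, Complex.conj_ofReal]
  ring

theorem flux_eq_discreteFlux (hαβ : Nat.Coprime α β) (hα : 0 < α) (hlt : α < β) (hδ : 1 ≤ δ)
    (hAB : IsDirichletToNeumann q lam A B) {u v : Tube α β δ → ℂ}
    (hu : u ∈ V α β δ q lam) (hv : v ∈ V α β δ q lam) :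
    flux u v = (2 * Complex.I)⁻¹ * B * discreteFlux (vals u) (vals v) := by
  classical
  have hc : crossing α β δ = ((band α β δ (-β) 0).image (fun p => ((p, Dir.right) : Edge α β δ)) ∪
      (band α β δ (-α) 0).image (fun p => ((p, Dir.down) : Edge α β δ)) : Finset (Edge α β δ)) := by
    ext ⟨p, d⟩
    rw [mem_crossing hα hlt]
    cases d <;> simp [mem_band hαβ hδ]
  have hinj : ∀ d : Dir, Function.Injective fun p : G α β δ => ((p, d) : Edge α β δ) :=
    fun d p p' h => congrArg Prod.fst h
  unfold flux
  rw [hc, finsum_mem_coe_finset, Finset.sum_union, Finset.sum_image (hinj _).injOn,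
    Finset.sum_image (hinj _).injOn]
  · simp only [edgeFlux_eq hAB hu hv]
    unfold discreteFlux
    rw [mul_add, Finset.mul_sum, Finset.mul_sum]
    rfl
  · rw [Finset.disjoint_left]
    intro e he he'
    obtain ⟨p, -, rfl⟩ := Finset.mem_image.1 he
    obtain ⟨p', -, h⟩ := Finset.mem_image.1 he'
    cases congrArg Prod.snd h

/-! ### Translations, conjugation and restriction as maps on `V_lam` -/

variable (α β δ q lam) in
/-- The translation by `g` on `V_lam`. -/
def shiftV (g : G α β δ) : Module.End ℂ (V α β δ q lam) where
  toFun u := ⟨u.1 ∘ shift g, comp_shift_mem_V g u.2⟩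
  map_add' _ _ := rfl
  map_smul' _ _ := rfl

theorem shift_shift (g g' : G α β δ) (x : Tube α β δ) : shift g (shift g' x) = shift (g' + g) x := by
  cases x <;> simp [shift, add_assoc]

theorem shift_zero (x : Tube α β δ) : shift 0 x = x := by
  cases x <;> simp [shift]

theorem shiftV_shiftV (g g' : G α β δ) (u : V α β δ q lam) :
    shiftV α β δ q lam g (shiftV α β δ q lam g' u) = shiftV α β δ q lam (g + g') u := by
  apply Subtype.ext
  funext x
  change u.1 (shift g' (shift g x)) = u.1 (shift (g + g') x)
  rw [shift_shift]

theorem shiftV_zero (u : V α β δ q lam) : shiftV α β δ q lam 0 u = u := by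
  apply Subtype.ext
  funext x
  exact congrArg u.1 (shift_zero x)

/-- Complex conjugation on `V_lam`. -/
def conjV (hq : GoodPot q lam) : V α β δ q lam →ₛₗ[starRingEnd ℂ] V α β δ q lam where
  toFun u := ⟨fun x => conj (u.1 x), conj_mem_V hq u.2⟩
  map_add' u v := Subtype.ext (funext fun x => map_add conj (u.1 x) (v.1 x))
  map_smul' c u := Subtype.ext (funext fun x => map_mul conj c (u.1 x))

variable (α β δ q lam) in
/-- The restriction of functions in `V_lam` to `𝒱₀`. -/
def restrV : V α β δ q lam →ₗ[ℂ] (V0 α β δ → ℂ) where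
  toFun u := restr u.1 0
  map_add' _ _ := rfl
  map_smul' _ _ := rfl

theorem restr_zero_apply (u : Tube α β δ → ℂ) (p : V0 α β δ) : restr u 0 p = vals u p := by
  simp [restr, vals]

/-- Two extensions compose: from `𝒱₀` to all vertices by the difference equation, then into the
edges by the boundary value problem. Both exist and are unique. -/
theorem restrV_bijective (hα : 0 < α) (hlt : α < β) (hAB : IsDirichletToNeumann q lam A B) :
    Function.Bijective (restrV α β δ q lam) := by
  constructor
  · rw [← LinearMap.ker_eq_bot, LinearMap.ker_eq_bot']
    intro u hu
    refine Subtype.ext (eq_zero_of_vals_eq_zero hAB u.2 fun p => ?_)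
    refine (isDiscrete_vals hAB u.2).eq_zero hα hlt (fun p hp => ?_) p
    rw [← restr_zero_apply u.1 ⟨p, hp⟩]
    exact congrFun hu ⟨p, hp⟩
  · intro g
    obtain ⟨u, hu, h⟩ := exists_mem_V_vals_eq hAB
      (isDiscrete_discreteExt hα hlt ((-(4 * A / B) : ℝ) : ℂ) g)
    refine ⟨⟨u, hu⟩, funext fun p => ?_⟩
    change restr u 0 p = g p
    rw [restr_zero_apply, h, discreteExt_of_mem]

/-- Functions in `V_lam` correspond to arbitrary functions on `𝒱₀`. -/
def restrEquiv (hα : 0 < α) (hlt : α < β) (hAB : IsDirichletToNeumann q lam A B) :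
    V α β δ q lam ≃ₗ[ℂ] (V0 α β δ → ℂ) :=
  LinearEquiv.ofBijective (restrV α β δ q lam) (restrV_bijective hα hlt hAB)

theorem restr_eq (u : V α β δ q lam) (m : ℤ) :
    restr u.1 m = restrV α β δ q lam (shiftV α β δ q lam (m • hh α β δ) u) := by
  funext p
  change _ = u.1 (shift (m • hh α β δ) (Tube.vertex (p.1 + (0 : ℤ) • hh α β δ)))
  simp [restr, shift]

theorem restr_add_one (u : V α β δ q lam) (m : ℤ) :
    restr u.1 (m + 1) = restrV α β δ q lam
      (shiftV α β δ q lam (hh α β δ) (shiftV α β δ q lam (m • hh α β δ) u)) := by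
  rw [restr_eq, shiftV_shiftV, add_zsmul, one_zsmul, add_comm]

/-! ### The propagator and its spectrum -/

theorem IsPropagator.apply_restrV {P : Module.End ℂ (V0 α β δ → ℂ)} (hP : IsPropagator q lam P)
    (u : V α β δ q lam) :
    P (restrV α β δ q lam u) = restrV α β δ q lam (shiftV α β δ q lam (hh α β δ) u) := by
  have h := hP.2 u.1 u.2 0
  rw [restr_add_one, restr_eq, zero_zsmul, shiftV_zero] at h
  exact h.symm

/-- The propagator is the shift conjugated by the restriction to `𝒱₀`; it is unique because every
function on `𝒱₀` is a restriction. -/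
theorem existsUnique_propagator (hα : 0 < α) (hlt : α < β)
    (hAB : IsDirichletToNeumann q lam A B) :
    ∃! P : Module.End ℂ (V0 α β δ → ℂ), IsPropagator q lam P := by
  set Φ := restrEquiv (δ := δ) hα hlt hAB
  have hΦ : ∀ u, Φ u = restrV α β δ q lam u := fun u => rfl
  refine ⟨Φ.toLinearMap ∘ₗ shiftV α β δ q lam (hh α β δ) ∘ₗ Φ.symm.toLinearMap, ⟨?_, ?_⟩, ?_⟩
  · have hb : Function.Bijective (shiftV α β δ q lam (hh α β δ)) :=
      Function.bijective_iff_has_inverse.2 ⟨shiftV α β δ q lam (-hh α β δ),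
        fun u => by rw [shiftV_shiftV, neg_add_cancel, shiftV_zero],
        fun u => by rw [shiftV_shiftV, add_neg_cancel, shiftV_zero]⟩
    exact Φ.bijective.comp (hb.comp Φ.symm.bijective)
  · intro u hu m
    rw [restr_add_one ⟨u, hu⟩, restr_eq ⟨u, hu⟩, ← hΦ, ← hΦ]
    simp
  · intro P hP
    refine LinearMap.ext fun g => ?_
    obtain ⟨u, rfl⟩ := Φ.surjective g
    simp only [LinearMap.comp_apply, LinearEquiv.coe_coe, LinearEquiv.symm_apply_apply]
    exact hP.apply_restrV u

theorem hasEigenvector_iff (hα : 0 < α) (hlt : α < β) (hAB : IsDirichletToNeumann q lam A B)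
    {P : Module.End ℂ (V0 α β δ → ℂ)} (hP : IsPropagator q lam P) {w : ℂ} {u : V α β δ q lam} :
    P.HasEigenvector w (restrV α β δ q lam u) ↔
      (shiftV α β δ q lam (hh α β δ)).HasEigenvector w u := by
  have hinj := (restrV_bijective (δ := δ) hα hlt hAB).1
  simp only [Module.End.hasEigenvector_iff, Module.End.mem_eigenspace_iff]
  rw [hP.apply_restrV, ← map_smul, hinj.eq_iff, Ne, ← map_zero (restrV α β δ q lam), hinj.eq_iff]

theorem hasEigenvalue_iff (hα : 0 < α) (hlt : α < β) (hAB : IsDirichletToNeumann q lam A B)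
    {P : Module.End ℂ (V0 α β δ → ℂ)} (hP : IsPropagator q lam P) {w : ℂ} :
    P.HasEigenvalue w ↔ (shiftV α β δ q lam (hh α β δ)).HasEigenvalue w := by
  constructor
  · intro h
    obtain ⟨g, hg⟩ := h.exists_hasEigenvector
    obtain ⟨u, rfl⟩ := (restrV_bijective (δ := δ) hα hlt hAB).2 g
    exact Module.End.hasEigenvalue_of_hasEigenvector ((hasEigenvector_iff hα hlt hAB hP).1 hg)
  · intro h
    obtain ⟨u, hu⟩ := h.exists_hasEigenvector
    exact Module.End.hasEigenvalue_of_hasEigenvector ((hasEigenvector_iff hα hlt hAB hP).2 hu)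

theorem shiftV_zsmul_of_eigen {u : V α β δ q lam} {w : ℂ} (hw : w ≠ 0)
    (h : shiftV α β δ q lam (hh α β δ) u = w • u) (m : ℤ) :
    shiftV α β δ q lam (m • hh α β δ) u = w ^ m • u := by
  induction m with
  | zero => rw [zero_zsmul, shiftV_zero, zpow_zero, one_smul]
  | succ n ih =>
    rw [add_zsmul, one_zsmul, ← shiftV_shiftV, h, map_smul, ih, smul_smul, zpow_add_one₀ hw,
      mul_comm]
  | pred n ih =>
    have h1 : shiftV α β δ q lam (-hh α β δ) u = w⁻¹ • u := by
      rw [eq_inv_smul_iff₀ hw, ← map_smul, ← h, shiftV_shiftV, neg_add_cancel, shiftV_zero]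
    rw [sub_zsmul, one_zsmul, ← shiftV_shiftV, h1, map_smul, ih,
      smul_smul, zpow_sub_one₀ hw, mul_comm]

/-- The energy flux as a sesquilinear form on `V_lam`. -/
def fluxForm (hαβ : Nat.Coprime α β) (hα : 0 < α) (hlt : α < β) (hδ : 1 ≤ δ)
    (hAB : IsDirichletToNeumann q lam A B) :
    V α β δ q lam →ₗ⋆[ℂ] V α β δ q lam →ₗ[ℂ] ℂ :=
  LinearMap.mk₂'ₛₗ (starRingEnd ℂ) (RingHom.id ℂ) (fun u v => flux u.1 v.1)
    (fun u u' v => by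
      rw [flux_eq_discreteFlux hαβ hα hlt hδ hAB (u + u').2 v.2,
        flux_eq_discreteFlux hαβ hα hlt hδ hAB u.2 v.2,
        flux_eq_discreteFlux hαβ hα hlt hδ hAB u'.2 v.2, ← mul_add]
      congr 1
      simp only [discreteFlux, vals, Submodule.coe_add, Pi.add_apply, map_add]
      rw [add_add_add_comm, ← Finset.sum_add_distrib, ← Finset.sum_add_distrib]
      congr 1 <;> exact Finset.sum_congr rfl fun p _ => by ring)
    (fun c u v => by
      rw [flux_eq_discreteFlux hαβ hα hlt hδ hAB (c • u).2 v.2,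
        flux_eq_discreteFlux hαβ hα hlt hδ hAB u.2 v.2, smul_eq_mul, mul_left_comm]
      congr 1
      simp only [discreteFlux, vals, Submodule.coe_smul, Pi.smul_apply, smul_eq_mul, map_mul]
      rw [mul_add, Finset.mul_sum, Finset.mul_sum]
      congr 1 <;> exact Finset.sum_congr rfl fun p _ => by ring)
    (fun u v v' => by
      rw [flux_eq_discreteFlux hαβ hα hlt hδ hAB u.2 (v + v').2,
        flux_eq_discreteFlux hαβ hα hlt hδ hAB u.2 v.2,
        flux_eq_discreteFlux hαβ hα hlt hδ hAB u.2 v'.2, ← mul_add]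
      congr 1
      simp only [discreteFlux, vals, Submodule.coe_add, Pi.add_apply]
      rw [add_add_add_comm, ← Finset.sum_add_distrib, ← Finset.sum_add_distrib]
      congr 1 <;> exact Finset.sum_congr rfl fun p _ => by ring)
    (fun c u v => by
      rw [flux_eq_discreteFlux hαβ hα hlt hδ hAB u.2 (c • v).2,
        flux_eq_discreteFlux hαβ hα hlt hδ hAB u.2 v.2, smul_eq_mul, mul_left_comm]
      congr 1
      simp only [discreteFlux, vals, Submodule.coe_smul, Pi.smul_apply, smul_eq_mul,
        RingHom.id_apply]
      rw [mul_add, Finset.mul_sum, Finset.mul_sum]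
      congr 1 <;> exact Finset.sum_congr rfl fun p _ => by ring)

theorem fluxForm_apply (hαβ : Nat.Coprime α β) (hα : 0 < α) (hlt : α < β) (hδ : 1 ≤ δ)
    (hAB : IsDirichletToNeumann q lam A B) (u v : V α β δ q lam) :
    fluxForm hαβ hα hlt hδ hAB u v =
      (2 * Complex.I)⁻¹ * B * discreteFlux (vals u.1) (vals v.1) :=
  flux_eq_discreteFlux hαβ hα hlt hδ hAB u.2 v.2

theorem discreteFlux_swap (f g : G α β δ → ℂ) : discreteFlux g f = -conj (discreteFlux f g) := by
  simp only [discreteFlux, map_mul, map_add, map_sum, map_sub, Complex.conj_conj, neg_add,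
    ← Finset.sum_neg_distrib]
  congr 1 <;> exact Finset.sum_congr rfl fun p _ => by ring

theorem discreteFlux_conj (f g : G α β δ → ℂ) :
    discreteFlux (fun p => conj (f p)) (fun p => conj (g p)) = conj (discreteFlux f g) := by
  simp only [discreteFlux, map_mul, map_add, map_sum, map_sub]

/-- The factor `B/(2i)` is imaginary. Hence the anti-Hermitian discrete flux becomes Hermitian, and
conjugating both arguments costs a sign. -/
theorem conj_inv_two_I_mul (B : ℝ) :
    conj ((2 * Complex.I)⁻¹ * (B : ℂ)) = -((2 * Complex.I)⁻¹ * B) := by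
  rw [map_mul, map_inv₀, map_mul, Complex.conj_I, Complex.conj_ofReal, map_ofNat]
  simp

theorem isFluxForm_fluxForm (hαβ : Nat.Coprime α β) (hα : 0 < α) (hlt : α < β) (hδ : 1 ≤ δ)
    (hAB : IsDirichletToNeumann q lam A B) :
    IsFluxForm (shiftV α β δ q lam (hh α β δ)) (fluxForm hαβ hα hlt hδ hAB)
      (conjV hAB.goodPot) where
  symm u v := by
    rw [fluxForm_apply, fluxForm_apply]
    rw [discreteFlux_swap, map_mul, conj_inv_two_I_mul]
    ring
  nondegenerate u h := by
    refine (restrV_bijective hα hlt hAB).1 ?_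
    rw [map_zero]
    funext p
    change restr u.1 0 p = 0
    rw [restr_zero_apply]
    refine discreteFlux_nondegenerate hαβ hα hlt hδ (κ := ((-(4 * A / B) : ℝ) : ℂ))
      (fun g hg => ?_) p p.2
    obtain ⟨v, hv, rfl⟩ := exists_mem_V_vals_eq hAB hg
    have h1 := h ⟨v, hv⟩
    rw [fluxForm_apply] at h1
    have hB : (B : ℂ) ≠ 0 := by exact_mod_cast hAB.ne_zero
    simpa [hB] using h1
  invariant u v := by
    have h : ∀ u : V α β δ q lam, vals (shiftV α β δ q lam (hh α β δ) u).1 =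
        fun p => vals u.1 (p + hh α β δ) := fun u => rfl
    rw [fluxForm_apply, fluxForm_apply, h, h, discreteFlux_shift hαβ hlt hδ
      (isDiscrete_vals hAB u.2) (isDiscrete_vals hAB v.2)]
  conj_comm u := rfl
  conj_flux u v := by
    have h : ∀ u : V α β δ q lam, vals (conjV hAB.goodPot u).1 = fun p => conj (vals u.1 p) :=
      fun u => rfl
    rw [fluxForm_apply, fluxForm_apply, h, h, discreteFlux_conj, map_mul, conj_inv_two_I_mul]
    ring

end Tube

/-! ### Eigenmodes -/

section Modes

variable {α β δ : ℕ} {q : ℝ → ℝ} {lam : ℝ}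

theorem ne_zero_of_hasEigenvector_shiftV {g : G α β δ} {w : ℂ} {u : V α β δ q lam}
    (h : (shiftV α β δ q lam g).HasEigenvector w u) : w ≠ 0 := by
  rintro rfl
  refine h.2 ?_
  have h1 := h.apply_eq_smul
  rw [zero_smul] at h1
  rw [← shiftV_zero u, ← neg_add_cancel g, ← shiftV_shiftV, h1, map_zero]

theorem restr_of_hasEigenvector {w : ℂ} {u : V α β δ q lam}
    (h : (shiftV α β δ q lam (hh α β δ)).HasEigenvector w u) (m : ℤ) :
    restr u.1 m = w ^ m • restr u.1 0 := by
  rw [restr_eq,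
    shiftV_zsmul_of_eigen (ne_zero_of_hasEigenvector_shiftV h) h.apply_eq_smul, map_smul]
  rfl

theorem comp_shift_of_hasEigenvector {g : G α β δ} {w : ℂ} {u : V α β δ q lam}
    (h : (shiftV α β δ q lam g).HasEigenvector w u) : u.1 ∘ shift g = w • u.1 :=
  congrArg Subtype.val h.apply_eq_smul

theorem ncard_setOf_eq_choice {d : ℕ} {R : Fin d → Fin 2 → Prop} (c : Fin d → Fin 2)
    (h : ∀ j k, R j k ↔ k = c j) : {p : Fin d × Fin 2 | R p.1 p.2}.ncard = d := by
  have h1 : {p : Fin d × Fin 2 | R p.1 p.2} = (fun j => (j, c j)) '' Set.univ := by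
    ext ⟨j, k⟩
    simp only [Set.mem_ofPred_eq, h, Set.image_univ, Set.mem_range, Prod.mk.injEq]
    constructor
    · rintro rfl
      exact ⟨j, rfl, rfl⟩
    · rintro ⟨i, rfl, rfl⟩
      rfl
  rw [h1, Set.ncard_image_of_injective _ fun i j hij => congrArg Prod.fst hij, Set.ncard_univ]
  simp

/-- Indices start at `0`, so the exponent `l + 1` gives the first mode flux `-1` and the second flux
`1`. -/
theorem isRightward_isLeftward_iff_of_norm_eq_one {w : Fin 2 → ℂ} {u : Fin 2 → Tube α β δ → ℂ}
    (hw : ‖w 0‖ = 1) (hw' : w 1 = conj (w 0))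
    (hu : ∀ k l, flux (u k) (u l) = if k = l then (-1 : ℂ) ^ ((l : ℕ) + 1) else 0) (k : Fin 2) :
    (IsRightward (w k) (u k) ↔ k = 1) ∧ (IsLeftward (w k) (u k) ↔ k = 0) := by
  have hw1 : ‖w 1‖ = 1 := by rw [hw', RCLike.norm_conj, hw]
  have h0 := hu 0 0
  have h1 := hu 1 1
  fin_cases k
  · simp [IsRightward, IsLeftward, hw, h0]
  · simp [IsRightward, IsLeftward, hw1, h1]

theorem isRightward_isLeftward_iff_of_norm_lt_one {w : Fin 2 → ℂ} {u : Fin 2 → Tube α β δ → ℂ}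
    (hw0 : w 0 ≠ 0) (hw : ‖w 0‖ < 1) (hw' : w 1 = (conj (w 0))⁻¹) (k : Fin 2) :
    (IsRightward (w k) (u k) ↔ k = 0) ∧ (IsLeftward (w k) (u k) ↔ k = 1) := by
  have hw1 : 1 < ‖w 1‖ := by
    rw [hw', norm_inv, RCLike.norm_conj]
    exact (one_lt_inv₀ (norm_pos_iff.2 hw0)).2 hw
  fin_cases k
  · simp [IsRightward, IsLeftward, hw, hw.ne, hw.le]
  · simp [IsRightward, IsLeftward, hw1, hw1.ne', hw1.le]

end Modes

end QuantumTube

end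

/-! ### The modes of the tube -/

open QuantumTube in
theorem theorem1 (α β δ : ℕ) (hαβ : Nat.Coprime α β) (hα : 0 < α) (hlt : α < β) (hδ : 1 ≤ δ)
    (q : ℝ → ℝ)
    (hq_meas : AEMeasurable q (MeasureTheory.volume.restrict (Set.Icc (0 : ℝ) 1)))
    (hq_bdd : ∃ C : ℝ, ∀ x ∈ Set.Icc (0 : ℝ) 1, -C < q x ∧ q x < C)
    (hq_symm : ∀ x ∈ Set.Icc (0 : ℝ) 1, q (1 - x) = q x)
    (lam : ℝ) (hlam : lam ∉ dirichletSpectrum q) :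
    -- the propagator exists and is unique
    (∃! P : Module.End ℂ (V0 α β δ → ℂ), IsPropagator q lam P) ∧
    ∀ P : Module.End ℂ (V0 α β δ → ℂ), IsPropagator q lam P →
      -- every eigenvector of the propagator comes from a unique eigenmode
      (∀ (w : ℂ) (u₀ : V0 α β δ → ℂ), P.HasEigenvector w u₀ →
        ∃ u ∈ V α β δ q lam, restr u 0 = u₀ ∧
          (∀ v ∈ V α β δ q lam, restr v 0 = u₀ → v = u) ∧
          (∀ m : ℤ, restr u m = w ^ m • u₀) ∧
          u ∘ shift (hh α β δ) = w • u) ∧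
      -- the case of distinct eigenvalues
      ({w : ℂ | P.HasEigenvalue w}.ncard = 2 * β * δ →
        Submodule.span ℂ {u | u ∈ V α β δ q lam ∧ ∃ w : ℂ, P.HasEigenvector w (restr u 0)} =
            V α β δ q lam ∧
        ∃ N : ℕ, N ≤ β * δ ∧
        ∃ (w : Fin (β * δ) → Fin 2 → ℂ) (u : Fin (β * δ) → Fin 2 → Tube α β δ → ℂ),
          -- the pairs of eigenvalues
          (∀ j : Fin (β * δ), (j : ℕ) < N → ‖w j 0‖ = 1 ∧ w j 1 = conj (w j 0)) ∧
          (∀ j : Fin (β * δ), N ≤ (j : ℕ) → w j 0 ≠ 0 ∧ ‖w j 0‖ < 1 ∧ w j 1 = (conj (w j 0))⁻¹) ∧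
          (∀ j k j' k', w j k = w j' k' → j = j' ∧ k = k') ∧
          {z : ℂ | P.HasEigenvalue z} = {z : ℂ | ∃ j k, w j k = z} ∧
          -- the corresponding eigenmodes
          (∀ j k, u j k ∈ V α β δ q lam ∧
            P.HasEigenvector (w j k) (restr (u j k) 0) ∧
            (∀ m : ℤ, restr (u j k) m = w j k ^ m • restr (u j k) 0) ∧
            u j k ∘ shift (hh α β δ) = w j k • u j k ∧
            ∃ z₂ : ℂ, u j k ∘ shift (vv α β δ) = z₂ • u j k) ∧
          Submodule.span ℂ {f | ∃ j k, u j k = f} = V α β δ q lam ∧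
          -- the flux interactions
          (∀ (j : Fin (β * δ)) (k l : Fin 2), (j : ℕ) < N →
            flux (u j k) (u j l) = if k = l then (-1 : ℂ) ^ ((l : ℕ) + 1) else 0) ∧
          (∀ (j : Fin (β * δ)) (k l : Fin 2), N ≤ (j : ℕ) → flux (u j k) (u j l) = if k = l then 0 else 1) ∧
          (∀ j j' k l, j ≠ j' → flux (u j k) (u j' l) = 0) ∧
          -- the rightward and leftward modes
          (∀ j, (IsRightward (w j 0) (u j 0) ∧ IsLeftward (w j 1) (u j 1)) ∨
            (IsLeftward (w j 0) (u j 0) ∧ IsRightward (w j 1) (u j 1))) ∧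
          {p : Fin (β * δ) × Fin 2 | IsRightward (w p.1 p.2) (u p.1 p.2)}.ncard = β * δ ∧
          {p : Fin (β * δ) × Fin 2 | IsLeftward (w p.1 p.2) (u p.1 p.2)}.ncard = β * δ) := by
  classical
  obtain ⟨A, B, hB, h1, h2, h3⟩ := exists_dirichletToNeumann
    (goodPot_of_bounded hq_meas hq_bdd lam) hq_symm hlam
  have hAB : IsDirichletToNeumann q lam A B :=
    ⟨goodPot_of_bounded hq_meas hq_bdd lam, hB, h1, h2, h3⟩
  refine ⟨existsUnique_propagator hα hlt hAB, fun P hP => ?_⟩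
  set Φ := restrEquiv (δ := δ) hα hlt hAB
  have hΦ : ∀ u, Φ u = restr u.1 0 := fun u => rfl
  refine ⟨fun w u₀ hu₀ => ?_, fun hcard => ?_⟩
  · obtain ⟨u, rfl⟩ := Φ.surjective u₀
    have hu := (hasEigenvector_iff hα hlt hAB hP).1 hu₀
    exact ⟨u.1, u.2, rfl,
      fun v hv h => congrArg Subtype.val (Φ.injective (a₁ := ⟨v, hv⟩) (a₂ := u) h),
      restr_of_hasEigenvector hu, comp_shift_of_hasEigenvector hu⟩
  obtain ⟨hfinite, hcardV0⟩ := finite_V0 (δ := δ) hαβ hα hlt hδ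
  have := Fintype.ofFinite (V0 α β δ)
  have : FiniteDimensional ℂ (V α β δ q lam) := Φ.symm.finiteDimensional
  have hd : Module.finrank ℂ (V α β δ q lam) = 2 * (β * δ) := by
    rw [Φ.finrank_eq, Module.finrank_pi, ← Nat.card_eq_fintype_card, hcardV0]
  have hev : {z : ℂ | P.HasEigenvalue z} =
      {z : ℂ | (shiftV α β δ q lam (hh α β δ)).HasEigenvalue z} :=
    Set.ext fun z => hasEigenvalue_iff hα hlt hAB hP
  have hT : {z : ℂ | (shiftV α β δ q lam (hh α β δ)).HasEigenvalue z}.ncard =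
      Module.finrank ℂ (V α β δ q lam) := by rw [← hev, hcard, hd, mul_assoc]
  obtain ⟨N, hN, w, u, hw1, hw2, hinj, hrange, hvec, hspan, hflux1, hflux2, hflux3⟩ :=
    (isFluxForm_fluxForm hαβ hα hlt hδ hAB).exists_canonical_basis hT hd
  have hspan' : Submodule.span ℂ {f | ∃ j k, (u j k).1 = f} = V α β δ q lam := by
    have h := congrArg (Submodule.map (V α β δ q lam).subtype) hspan
    rw [Submodule.map_span, Submodule.map_top, Submodule.range_subtype, ← Set.range_comp] at h
    convert h using 2
    ext f
    simp
  -- In pair `j`, `c` is the index of the rightward mode and `c'` that of the leftward mode.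
  have hdir : ∀ j, ∃ c c' : Fin 2, ((c = 0 ∧ c' = 1) ∨ (c = 1 ∧ c' = 0)) ∧
      ∀ k, (IsRightward (w j k) (u j k).1 ↔ k = c) ∧ (IsLeftward (w j k) (u j k).1 ↔ k = c') := by
    intro j
    rcases lt_or_ge (j : ℕ) N with h | h
    · exact ⟨1, 0, Or.inr ⟨rfl, rfl⟩, isRightward_isLeftward_iff_of_norm_eq_one (w := w j)
        (u := fun k => (u j k).1) (hw1 j h).1 (hw1 j h).2 fun k l => hflux1 j k l h⟩
    · exact ⟨0, 1, Or.inl ⟨rfl, rfl⟩, isRightward_isLeftward_iff_of_norm_lt_one (w := w j)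
        (u := fun k => (u j k).1) (hw2 j h).1 (hw2 j h).2.1 (hw2 j h).2.2⟩
  choose c c' hcc' hdir using hdir
  refine ⟨le_antisymm (Submodule.span_le.2 fun f hf => hf.1) ?_, N, hN, w, fun j k => (u j k).1,
    hw1, hw2, hinj, hev.trans hrange, fun j k => ⟨(u j k).2,
      (hasEigenvector_iff hα hlt hAB hP).2 (hvec j k), restr_of_hasEigenvector (hvec j k),
      comp_shift_of_hasEigenvector (hvec j k), ?_⟩, hspan', hflux1, hflux2, hflux3, fun j => ?_,
    ncard_setOf_eq_choice c fun j k => (hdir j k).1,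
    ncard_setOf_eq_choice c' fun j k => (hdir j k).2⟩
  · refine hspan'.ge.trans (Submodule.span_mono ?_)
    rintro _ ⟨j, k, rfl⟩
    exact ⟨(u j k).2, w j k, (hasEigenvector_iff hα hlt hAB hP).2 (hvec j k)⟩
  · have hu := (hvec j k).apply_eq_smul
    -- The vertical shift commutes with the horizontal one, so it maps the one-dimensional
    -- eigenspace into itself.
    obtain ⟨z, hz⟩ := (eigenbasis_of_ncard_eq_finrank hT).1 (w j k) (u j k)
      (shiftV α β δ q lam (vv α β δ) (u j k)) (hvec j k).2 hu (by
        rw [shiftV_shiftV, add_comm, ← shiftV_shiftV, hu, map_smul])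
    exact ⟨z, congrArg Subtype.val hz⟩
  · have h0 := hdir j 0
    have h1 := hdir j 1
    rcases hcc' j with h | h
    · exact Or.inl ⟨h0.1.2 h.1.symm, h1.2.2 h.2.symm⟩
    · exact Or.inr ⟨h0.2.2 h.2.symm, h1.1.2 h.1.symm⟩
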